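/- **Fundamental equations of a pseudo-Finsler submersion.** *Setting.* A pseudo-Finsler metric on a manifold $\mathcal M$ is a smooth function $L\colon\mathcal A\to\mathbb R$ on an open subset $\mathcal A\subset T\mathcal M\setminus 0$ invariant under positive scaling (its elements are called admissible), with $L(\lambda v)=\lambda^2L(v)$ for $\lambda>0$, whose fundamental tensor $g_v(e,h)=\frac12\frac{\partial^2}{\partial s\,\partial t}L(v+se+th)|_{s=t=0}$ is nondegenerate for every $v\in\mathcal A$. Let $\nabla$ be its Levi-Civita–Chern connection, i.e. the unique torsion-free anisotropic connection with $\nabla g=0$. For an anisotropic vector field $\mathcal X$ (a smooth assignment $\mathcal A\ni v\mapsto\mathcal X_v\in T_{\pi(v)}\mathcal M$) put $\nabla^v_e\mathcal X=\nabla^v_e(\mathcal X_V)-(\dot\partial\mathcal X)_v(\nabla^v_eV)$, where $V$ is any local admissible extension of $v$ and $\dot\partial$ is the fibre derivative; $\nabla$ extends to anisotropic tensors by the product rule. The curvature is $R_v(b,e)h=\nabla^v_b\nabla_EH-\nabla^v_e\nabla_BH-\nabla^v_{[B,E]}H$ for any extensions $B,E,H$ of $b,e,h$. Let $\sigma\colon(\mathcal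 M,L)\to(\mathcal B,\tilde L)$ be a pseudo-Finsler submersion: a smooth surjective map with surjective differentials such that $L$ restricts to a pseudo-Finsler metric on the fibres, and such that for every $v\in\mathcal A$ that is $g_v$-orthogonal to $\ker\mathrm d\sigma$, the vector $\mathrm d\sigma(v)$ is admissible for $\tilde L$ and $\tilde L(\mathrm d\sigma(v))=L(v)$. Vectors in $\mathcal V_p=\ker\mathrm d\sigma_p$ are called vertical, and vectors $g_v$-orthogonal to $\mathcal V_p$ are called $g_v$-horizontal. Assume that $\mathcal V_p$ is $g_v$-nondegenerate for every $v\in\mathcal A\cap T_p\mathcal M$ and every $p$, and write $e=e^\top_v+e^\bot_v$ for the resulting decomposition into vertical and $g_v$-horizontal parts; for a vector field $E$, $E^\top$ and $E^\bot$ are anisotropic vector fields. With $\chi^v_he=(\nabla^v_hE^\bot)^\top_v+(\nabla^v_hE^\top)^\bot_v$ ($E$ any extension of $e$), define $$\mathbf T^v_be=\chi^v_{b^\top_v}e,\qquad \mathbf A^v_be=\chi^v_{b^\bot_v}e,$$ $$R^\top_v(b,e)h=\bigl(\nabla^v_b(\nabla_EH^\top)^\top-\nabla^v_e(\nabla_BH^\top)^\top-\nabla^v_{[B,E]}H^\top\bigr)^\top_v,$$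 and let $R^\bot$ be given by the last formula with $\bot$ in place of $\top$ everywhere. *Statement.* For each admissible $v\in T_p\mathcal M$, all vertical $s',s,u,w\in T_p\mathcal M$ and all $g_v$-horizontal $x,y,z,z'\in T_p\mathcal M$: $\{0\}\quad g_v(R_v(w,u)s,s')=g_v(R^\top_v(w,u)s,s')+g_v(\mathbf T^v_ws,\mathbf T^v_us')-g_v(\mathbf T^v_us,\mathbf T^v_ws')$, $\{1\}\quad g_v(R_v(w,u)s,z)=g_v((\nabla_w\mathbf T)^v_us,z)-g_v((\nabla_u\mathbf T)^v_ws,z)$, $\{1'\}\quad g_v(R_v(x,u)s,w)=g_v(R^\top_v(x,u)s,w)-g_v(\mathbf T^v_us,\mathbf A^v_xw)+g_v(\mathbf A^v_xs,\mathbf T^v_uw)$, $\{2\}\quad g_v(R_v(x,u)s,z)=g_v((\nabla_x\mathbf T)^v_us,z)-g_v((\nabla_u\mathbf A)^v_xs,z)-g_v(\mathbf A^v_{\mathbf A^v_xu}s,z)-g_v(\mathbf T^v_ux,\mathbf T^v_sz)$, $\{2'\}\quad g_v(R_v(x,y)s,w)=g_v(R^\top_v(x,y)s,w)-g_v(\mathbf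 A^v_ys,\mathbf A^v_xw)+g_v(\mathbf A^v_xs,\mathbf A^v_yw)$, $\{3\}\quad g_v(R_v(x,y)s,z)=g_v((\nabla_x\mathbf A)^v_ys,z)-g_v((\nabla_y\mathbf A)^v_xs,z)-g_v(\mathbf A^v_yx,\mathbf T^v_sz)+g_v(\mathbf A^v_xy,\mathbf T^v_sz)$, $\{4\}\quad g_v(R_v(x,y)z,z')=g_v(R^\bot_v(x,y)z,z')+g_v(\mathbf A^v_xz,\mathbf A^v_yz')-g_v(\mathbf A^v_yz,\mathbf A^v_xz')$. -/

import Mathlib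

open scoped Manifold ContDiff

noncomputable section

/-! ## Fibrewise derivatives, in coordinates

A Lagrangian in coordinates is a function `ℓ : E × E → ℝ`, `(x, y) ↦ ℓ (x, y)`, where `x` is the
position and `y` the velocity (only its values on an open set matter).  An anisotropic vector field
in coordinates is a function `𝒳 : E × E → E`. -/

namespace Finsler

/-- `½ D²f(y)`; for the restriction `f` of a Lagrangian to one tangent space this is the
fundamental tensor `g_y(e, h) = ½ ∂²f(y + s e + t h)/∂s∂t` at `s = t = 0`. -/
def halfHessian {E : Type*} [NormedAddCommGroup E] [NormedSpace ℝ E] (f : E → ℝ) (y : E) :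
    E →L[ℝ] E →L[ℝ] ℝ :=
  (1 / 2 : ℝ) • fderiv ℝ (fderiv ℝ f) y

namespace Coord

variable {E : Type*} [NormedAddCommGroup E] [NormedSpace ℝ E]

/-- The fundamental tensor `g_v(e, h)` at `a = (x, v)`. -/
def g (ℓ : E × E → ℝ) (a : E × E) : E →L[ℝ] E →L[ℝ] ℝ :=
  halfHessian (fun y => ℓ (a.1, y)) a.2

/-- The Cartan tensor `C_v(b, e, h) = ½ ∂ g_{v+tb}(e, h)/∂t` at `t = 0`, with `a = (x, v)`. -/
def cartan (ℓ : E × E → ℝ) (a : E × E) : E →L[ℝ] E →L[ℝ] E →L[ℝ] ℝ :=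
  (1 / 2 : ℝ) • fderiv ℝ (fun y => g ℓ (a.1, y)) a.2

/-- The derivative of the fundamental tensor in the position variable:
`dg ℓ (x, v) b e h = ∂ g_{(x + tb, v)}(e, h)/∂t` at `t = 0`. -/
def dg (ℓ : E × E → ℝ) (a : E × E) : E →L[ℝ] E →L[ℝ] E →L[ℝ] ℝ :=
  fderiv ℝ (fun x => g ℓ (x, a.2)) a.1

/-- The vector `e` with `g_v(e, b) = α(b)` for all `b`. -/
def sharp (ℓ : E × E → ℝ) (a : E × E) : (E →L[ℝ] ℝ) →L[ℝ] E :=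
  (g ℓ a).inverse

/-! ### The Levi-Civita--Chern connection

The Koszul formula for the torsion-free anisotropic connection with `∇ g = 0` reads, for the
coordinate (constant) vector fields `e, h, b`,
`2 g_v(Γ_v(e, h), b) = ∂_e g_v(h, b) + ∂_h g_v(e, b) - ∂_b g_v(e, h)`
`  - 2 C_v(Γ_v(e, v), h, b) - 2 C_v(Γ_v(h, v), e, b) + 2 C_v(Γ_v(b, v), e, h)`.
By homogeneity `C_v(v, ·, ·) = 0`, so inserting `h = v`, and then also `e = v`, determines
successively `Γ_v(v, v)`, `Γ_v(e, v)` and `Γ_v(e, h)`. -/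

/-- The vector `Γ_v(v, v)`. -/
def spray (ℓ : E × E → ℝ) (a : E × E) : E :=
  sharp ℓ a (dg ℓ a a.2 a.2 - (1 / 2 : ℝ) • ((dg ℓ a).flip a.2).flip a.2)

/-- The linear map `e ↦ Γ_v(e, v)` (the nonlinear connection). -/
def nonlin (ℓ : E × E → ℝ) (a : E × E) : E →L[ℝ] E :=
  (sharp ℓ a).comp
    ((1 / 2 : ℝ) • ((dg ℓ a).flip a.2 + dg ℓ a a.2 - ((dg ℓ a).flip a.2).flip)
      - cartan ℓ a (spray ℓ a))

/-- The Christoffel symbols `Γ_v(e, h)` of the Levi-Civita--Chern connection, that is `∇^v_e H`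
for the constant vector field `H = h`. -/
def Γ (ℓ : E × E → ℝ) (a : E × E) (e h : E) : E :=
  sharp ℓ a
    ((1 / 2 : ℝ) • (dg ℓ a e h + dg ℓ a h e - ((dg ℓ a).flip e).flip h)
      - cartan ℓ a (nonlin ℓ a e) h - cartan ℓ a (nonlin ℓ a h) e
      + (((cartan ℓ a).flip e).flip h).comp (nonlin ℓ a))

/-- The covariant derivative `∇^v_e 𝒳` of an anisotropic vector field at `a = (x, v)`:
`∇^v_e (𝒳_V) - (∂̇𝒳)_v(∇^v_e V)` for any extension `V` of `v`.  The derivatives of `V` cancel, and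
what remains is `(∂_e 𝒳)_v - (∂̇𝒳)_v(Γ_v(e, v)) + Γ_v(e, 𝒳_v)`. -/
def nabla (ℓ : E × E → ℝ) (𝒳 : E × E → E) (a : E × E) (e : E) : E :=
  fderiv ℝ 𝒳 a (e, -Γ ℓ a e a.2) + Γ ℓ a e (𝒳 a)

/-- The anisotropic vector field `∇_X 𝒳`, for a vector field `X`. -/
def nablaField (ℓ : E × E → ℝ) (X : E → E) (𝒳 : E × E → E) : E × E → E :=
  fun a => nabla ℓ 𝒳 a (X a.1)

/-- The curvature operator `∇^v_B ∇_E H - ∇^v_E ∇_B H - ∇^v_{[B,E]} H` for vector fields. -/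
def curvatureOp (ℓ : E × E → ℝ) (B X H : E → E) (a : E × E) : E :=
  nablaField ℓ B (nablaField ℓ X (fun c => H c.1)) a
    - nablaField ℓ X (nablaField ℓ B (fun c => H c.1)) a
    - nablaField ℓ (VectorField.lieBracket ℝ B X) (fun c => H c.1) a

/-- The curvature tensor `R_v(b, e)h`, evaluated through the constant extensions of `b, e, h`. -/
def curvature (ℓ : E × E → ℝ) (a : E × E) (b e h : E) : E :=
  curvatureOp ℓ (fun _ => b) (fun _ => e) (fun _ => h) a

/-! ### Vertical and horizontal parts

`K x` is the vertical space at `x`. -/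

/-- The space of vectors that are `g_v`-orthogonal to the vertical vectors. -/
def orthSpace (ℓ : E × E → ℝ) (K : E → Submodule ℝ E) (a : E × E) : Submodule ℝ E where
  carrier := {e | ∀ w ∈ K a.1, g ℓ a e w = 0}
  add_mem' := fun he hh w hw => by simp [he w hw, hh w hw]
  zero_mem' := fun w _ => by simp
  smul_mem' := fun c e he w hw => by simp [he w hw]

open Classical in
/-- The vertical part `e^⊤_v` of `e` in the `g_v`-orthogonal decomposition (which exists when the
vertical space is `g_v`-nondegenerate). -/
def top (ℓ : E × E → ℝ) (K : E → Submodule ℝ E) (a : E × E) (e : E) : E :=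
  if h : IsCompl (K a.1) (orthSpace ℓ K a) then Submodule.projection _ _ h e else 0

/-- The `g_v`-horizontal part `e^⊥_v` of `e`. -/
def bot (ℓ : E × E → ℝ) (K : E → Submodule ℝ E) (a : E × E) (e : E) : E :=
  e - top ℓ K a e

/-- The anisotropic vector field `𝒳^⊤`. -/
def topField (ℓ : E × E → ℝ) (K : E → Submodule ℝ E) (𝒳 : E × E → E) : E × E → E :=
  fun a => top ℓ K a (𝒳 a)

/-- The anisotropic vector field `𝒳^⊥`. -/
def botField (ℓ : E × E → ℝ) (K : E → Submodule ℝ E) (𝒳 : E × E → E) : E × E → E :=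
  fun a => bot ℓ K a (𝒳 a)

/-- The tensor `χ^v_h e = (∇^v_h E^⊥)^⊤_v + (∇^v_h E^⊤)^⊥_v`, with the constant extension `E` of
`e`. -/
def chi (ℓ : E × E → ℝ) (K : E → Submodule ℝ E) (a : E × E) (h e : E) : E :=
  top ℓ K a (nabla ℓ (botField ℓ K fun _ => e) a h)
    + bot ℓ K a (nabla ℓ (topField ℓ K fun _ => e) a h)

/-- The fundamental tensor `T^v_b e = χ^v_{b^⊤} e`. -/
def T (ℓ : E × E → ℝ) (K : E → Submodule ℝ E) (a : E × E) (b e : E) : E :=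
  chi ℓ K a (top ℓ K a b) e

/-- The fundamental tensor `A^v_b e = χ^v_{b^⊥} e`. -/
def A (ℓ : E × E → ℝ) (K : E → Submodule ℝ E) (a : E × E) (b e : E) : E :=
  chi ℓ K a (bot ℓ K a b) e

/-- The covariant derivative `(∇_h S)^v_b e = ∇^v_h(S_B X) - S^v_{∇^v_h B} e - S^v_b (∇^v_h X)` of
an anisotropic tensor of type `(1, 2)`, with the constant extensions `B, X` of `b, e`. -/
def nablaTensor (ℓ : E × E → ℝ) (S : E × E → E → E → E) (a : E × E) (h b e : E) : E :=
  nabla ℓ (fun c => S c b e) a h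
    - S a (nabla ℓ (fun _ => b) a h) e - S a b (nabla ℓ (fun _ => e) a h)

/-- The operator `(∇^v_B (∇_E H^⊤)^⊤ - ∇^v_E (∇_B H^⊤)^⊤ - ∇^v_{[B,E]} H^⊤)^⊤_v`. -/
def curvatureTopOp (ℓ : E × E → ℝ) (K : E → Submodule ℝ E) (B X H : E → E) (a : E × E) : E :=
  top ℓ K a
    (nablaField ℓ B (topField ℓ K (nablaField ℓ X (topField ℓ K fun c => H c.1))) a
      - nablaField ℓ X (topField ℓ K (nablaField ℓ B (topField ℓ K fun c => H c.1))) a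
      - nablaField ℓ (VectorField.lieBracket ℝ B X) (topField ℓ K fun c => H c.1) a)

/-- The operator `(∇^v_B (∇_E H^⊥)^⊥ - ∇^v_E (∇_B H^⊥)^⊥ - ∇^v_{[B,E]} H^⊥)^⊥_v`. -/
def curvatureBotOp (ℓ : E × E → ℝ) (K : E → Submodule ℝ E) (B X H : E → E) (a : E × E) : E :=
  bot ℓ K a
    (nablaField ℓ B (botField ℓ K (nablaField ℓ X (botField ℓ K fun c => H c.1))) a
      - nablaField ℓ X (botField ℓ K (nablaField ℓ B (botField ℓ K fun c => H c.1))) a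
      - nablaField ℓ (VectorField.lieBracket ℝ B X) (botField ℓ K fun c => H c.1) a)

/-- The vertical curvature tensor `R^⊤_v(b, e)h`, through constant extensions. -/
def curvatureTop (ℓ : E × E → ℝ) (K : E → Submodule ℝ E) (a : E × E) (b e h : E) : E :=
  curvatureTopOp ℓ K (fun _ => b) (fun _ => e) (fun _ => h) a

/-- The horizontal curvature tensor `R^⊥_v(b, e)h`, through constant extensions. -/
def curvatureBot (ℓ : E × E → ℝ) (K : E → Submodule ℝ E) (a : E × E) (b e h : E) : E :=
  curvatureBotOp ℓ K (fun _ => b) (fun _ => e) (fun _ => h) a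

end Coord

/-! ## Pseudo-Finsler manifolds and submersions -/

/-- The fundamental tensor `g_v(e, h)` at `v ∈ T_pM` of a function `L` on the tangent bundle. -/
def fundTensor {E : Type*} [NormedAddCommGroup E] [NormedSpace ℝ E]
    {M : Type*} [TopologicalSpace M] [ChartedSpace E M]
    (L : TangentBundle 𝓘(ℝ, E) M → ℝ) {p : M} (v e h : TangentSpace 𝓘(ℝ, E) p) : ℝ :=
  halfHessian (E := E) (fun y => L ⟨p, y⟩) v e h

/-- A pseudo-Finsler metric `L : 𝒜 → ℝ` on a manifold `M`; the values of `L` outside the set `𝒜`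
of admissible vectors are irrelevant. -/
structure PseudoFinslerMetric (E : Type*) [NormedAddCommGroup E] [NormedSpace ℝ E]
    (M : Type*) [TopologicalSpace M] [ChartedSpace E M] [IsManifold 𝓘(ℝ, E) ∞ M] where
  /-- the admissible vectors -/
  𝒜 : Set (TangentBundle 𝓘(ℝ, E) M)
  /-- the metric -/
  L : TangentBundle 𝓘(ℝ, E) M → ℝ
  isOpen_𝒜 : IsOpen 𝒜
  ne_zero : ∀ (p : M) (v : TangentSpace 𝓘(ℝ, E) p), (⟨p, v⟩ : TangentBundle 𝓘(ℝ, E) M) ∈ 𝒜 → v ≠ 0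
  smul_mem : ∀ (p : M) (v : TangentSpace 𝓘(ℝ, E) p) (c : ℝ), 0 < c →
    (⟨p, v⟩ : TangentBundle 𝓘(ℝ, E) M) ∈ 𝒜 → (⟨p, c • v⟩ : TangentBundle 𝓘(ℝ, E) M) ∈ 𝒜
  smooth : ContMDiffOn 𝓘(ℝ, E).tangent 𝓘(ℝ, ℝ) ∞ L 𝒜
  homogeneous : ∀ (p : M) (v : TangentSpace 𝓘(ℝ, E) p) (c : ℝ), 0 < c →
    (⟨p, v⟩ : TangentBundle 𝓘(ℝ, E) M) ∈ 𝒜 → L ⟨p, c • v⟩ = c ^ 2 * L ⟨p, v⟩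
  nondegenerate : ∀ (p : M) (v : TangentSpace 𝓘(ℝ, E) p),
    (⟨p, v⟩ : TangentBundle 𝓘(ℝ, E) M) ∈ 𝒜 →
      ∀ e : TangentSpace 𝓘(ℝ, E) p, (∀ h, fundTensor L v e h = 0) → e = 0

section Submersion

variable {E : Type*} [NormedAddCommGroup E] [NormedSpace ℝ E]
  {F : Type*} [NormedAddCommGroup F] [NormedSpace ℝ F]
  {M : Type*} [TopologicalSpace M] [ChartedSpace E M] [IsManifold 𝓘(ℝ, E) ∞ M]
  {B : Type*} [TopologicalSpace B] [ChartedSpace F B] [IsManifold 𝓘(ℝ, F) ∞ B]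

/-- `v ∈ T_pM` is admissible. -/
def PseudoFinslerMetric.Admissible (m : PseudoFinslerMetric E M) {p : M}
    (v : TangentSpace 𝓘(ℝ, E) p) : Prop :=
  (⟨p, v⟩ : TangentBundle 𝓘(ℝ, E) M) ∈ m.𝒜

/-- The fundamental tensor `g_v(e, h)`. -/
def PseudoFinslerMetric.g (m : PseudoFinslerMetric E M) {p : M}
    (v e h : TangentSpace 𝓘(ℝ, E) p) : ℝ :=
  fundTensor m.L v e h

/-- The vertical space `ker dσ_p`. -/
def verticalSpace (E F : Type*) [NormedAddCommGroup E] [NormedSpace ℝ E]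
    [NormedAddCommGroup F] [NormedSpace ℝ F]
    {M : Type*} [TopologicalSpace M] [ChartedSpace E M]
    {B : Type*} [TopologicalSpace B] [ChartedSpace F B]
    (σ : M → B) (p : M) : Submodule ℝ (TangentSpace 𝓘(ℝ, E) p) :=
  LinearMap.ker (mfderiv 𝓘(ℝ, E) 𝓘(ℝ, F) σ p).toLinearMap

/-- `x` is `g_v`-horizontal: `g_v`-orthogonal to all vertical vectors. -/
def PseudoFinslerMetric.IsHorizontal (m : PseudoFinslerMetric E M) (F : Type*)
    [NormedAddCommGroup F] [NormedSpace ℝ F] {B : Type*} [TopologicalSpace B] [ChartedSpace F B]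
    (σ : M → B) {p : M} (v x : TangentSpace 𝓘(ℝ, E) p) : Prop :=
  ∀ w ∈ verticalSpace E F σ p, m.g v x w = 0

/-- The restriction of `g_v` to the vertical space is nondegenerate. -/
def PseudoFinslerMetric.VerticalNondegenerateAt (m : PseudoFinslerMetric E M) (F : Type*)
    [NormedAddCommGroup F] [NormedSpace ℝ F] {B : Type*} [TopologicalSpace B] [ChartedSpace F B]
    (σ : M → B) {p : M} (v : TangentSpace 𝓘(ℝ, E) p) : Prop :=
  ∀ u ∈ verticalSpace E F σ p, m.IsHorizontal F σ v u → u = 0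

/-- Pseudo-Finsler submersions. -/
structure IsPseudoFinslerSubmersion (m : PseudoFinslerMetric E M) (m' : PseudoFinslerMetric F B)
    (σ : M → B) : Prop where
  smooth : ContMDiff 𝓘(ℝ, E) 𝓘(ℝ, F) ∞ σ
  surjective : Function.Surjective σ
  surjective_mfderiv : ∀ p : M, Function.Surjective (mfderiv 𝓘(ℝ, E) 𝓘(ℝ, F) σ p)
  /-- The restriction of `L` to the tangent spaces of the fibres is a pseudo-Finsler metric (its
  fundamental tensor at a vertical admissible `v` is the restriction of `g_v`, and the remaining
  requirements are inherited). -/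
  fiber_nondegenerate : ∀ (p : M) (v : TangentSpace 𝓘(ℝ, E) p), m.Admissible v →
    v ∈ verticalSpace E F σ p → m.VerticalNondegenerateAt F σ v
  /-- `dσ` preserves the length of horizontal vectors. -/
  isometric : ∀ (p : M) (v : TangentSpace 𝓘(ℝ, E) p), m.Admissible v → m.IsHorizontal F σ v v →
    m'.Admissible (mfderiv 𝓘(ℝ, E) 𝓘(ℝ, F) σ p v) ∧
      m'.L ⟨σ p, mfderiv 𝓘(ℝ, E) 𝓘(ℝ, F) σ p v⟩ = m.L ⟨p, v⟩

/-! ### The tensors on the manifold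

All tensors are computed in an arbitrary chart `φ` around the point and carried back to `T_pM` by
`dφ`. -/

/-- `dφ_p : T_pM → E`. -/
def toChart (φ : OpenPartialHomeomorph M E) (p : M) : TangentSpace 𝓘(ℝ, E) p →L[ℝ] E :=
  mfderiv 𝓘(ℝ, E) 𝓘(ℝ, E) φ p

/-- `(d(φ⁻¹))_x : E → T_{φ⁻¹(x)}M`. -/
def ofChart (φ : OpenPartialHomeomorph M E) (x : E) :
    E →L[ℝ] TangentSpace 𝓘(ℝ, E) (φ.symm x) :=
  mfderiv 𝓘(ℝ, E) 𝓘(ℝ, E) φ.symm x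

/-- The inverse `E → T_pM` of `dφ_p`, for `p` in the domain of `φ`. -/
def ofChartAt (φ : OpenPartialHomeomorph M E) (p : M) : E →L[ℝ] TangentSpace 𝓘(ℝ, E) p :=
  (toChart φ p).inverse

/-- The metric in the chart `φ`: `(x, y) ↦ L(d(φ⁻¹)_x y)`. -/
def PseudoFinslerMetric.inChart (m : PseudoFinslerMetric E M) (φ : OpenPartialHomeomorph M E) :
    E × E → ℝ :=
  fun a => m.L ⟨φ.symm a.1, ofChart φ a.1 a.2⟩

/-- The vertical spaces in the chart `φ`. -/
def verticalInChart (F : Type*) [NormedAddCommGroup F] [NormedSpace ℝ F]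
    {B : Type*} [TopologicalSpace B] [ChartedSpace F B]
    (σ : M → B) (φ : OpenPartialHomeomorph M E) (x : E) : Submodule ℝ E :=
  (verticalSpace E F σ (φ.symm x)).comap (ofChart φ x).toLinearMap

/-- The chart coordinates `(φ(p), dφ_p v)` of `v ∈ T_pM`. -/
def coords (φ : OpenPartialHomeomorph M E) {p : M} (v : TangentSpace 𝓘(ℝ, E) p) : E × E :=
  (φ p, toChart φ p v)

/-- The curvature tensor `R_v(b, e)h` of the Levi-Civita--Chern connection. -/
def PseudoFinslerMetric.R (m : PseudoFinslerMetric E M) (φ : OpenPartialHomeomorph M E) {p : M}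
    (v b e h : TangentSpace 𝓘(ℝ, E) p) : TangentSpace 𝓘(ℝ, E) p :=
  ofChartAt φ p (Coord.curvature (m.inChart φ) (coords φ v)
    (toChart φ p b) (toChart φ p e) (toChart φ p h))

/-- The vertical curvature tensor `R^⊤_v(b, e)h`. -/
def PseudoFinslerMetric.Rtop (m : PseudoFinslerMetric E M) (F : Type*)
    [NormedAddCommGroup F] [NormedSpace ℝ F] {B : Type*} [TopologicalSpace B] [ChartedSpace F B]
    (σ : M → B) (φ : OpenPartialHomeomorph M E) {p : M}
    (v b e h : TangentSpace 𝓘(ℝ, E) p) : TangentSpace 𝓘(ℝ, E) p :=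
  ofChartAt φ p (Coord.curvatureTop (m.inChart φ) (verticalInChart F σ φ) (coords φ v)
    (toChart φ p b) (toChart φ p e) (toChart φ p h))

/-- The horizontal curvature tensor `R^⊥_v(b, e)h`. -/
def PseudoFinslerMetric.Rbot (m : PseudoFinslerMetric E M) (F : Type*)
    [NormedAddCommGroup F] [NormedSpace ℝ F] {B : Type*} [TopologicalSpace B] [ChartedSpace F B]
    (σ : M → B) (φ : OpenPartialHomeomorph M E) {p : M}
    (v b e h : TangentSpace 𝓘(ℝ, E) p) : TangentSpace 𝓘(ℝ, E) p :=
  ofChartAt φ p (Coord.curvatureBot (m.inChart φ) (verticalInChart F σ φ) (coords φ v)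
    (toChart φ p b) (toChart φ p e) (toChart φ p h))

/-- The fundamental tensor `T^v_b e`. -/
def PseudoFinslerMetric.T (m : PseudoFinslerMetric E M) (F : Type*)
    [NormedAddCommGroup F] [NormedSpace ℝ F] {B : Type*} [TopologicalSpace B] [ChartedSpace F B]
    (σ : M → B) (φ : OpenPartialHomeomorph M E) {p : M}
    (v b e : TangentSpace 𝓘(ℝ, E) p) : TangentSpace 𝓘(ℝ, E) p :=
  ofChartAt φ p (Coord.T (m.inChart φ) (verticalInChart F σ φ) (coords φ v)
    (toChart φ p b) (toChart φ p e))

/-- The fundamental tensor `A^v_b e`. -/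
def PseudoFinslerMetric.A (m : PseudoFinslerMetric E M) (F : Type*)
    [NormedAddCommGroup F] [NormedSpace ℝ F] {B : Type*} [TopologicalSpace B] [ChartedSpace F B]
    (σ : M → B) (φ : OpenPartialHomeomorph M E) {p : M}
    (v b e : TangentSpace 𝓘(ℝ, E) p) : TangentSpace 𝓘(ℝ, E) p :=
  ofChartAt φ p (Coord.A (m.inChart φ) (verticalInChart F σ φ) (coords φ v)
    (toChart φ p b) (toChart φ p e))

/-- The covariant derivative `(∇_h T)^v_b e`. -/
def PseudoFinslerMetric.nablaT (m : PseudoFinslerMetric E M) (F : Type*)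
    [NormedAddCommGroup F] [NormedSpace ℝ F] {B : Type*} [TopologicalSpace B] [ChartedSpace F B]
    (σ : M → B) (φ : OpenPartialHomeomorph M E) {p : M}
    (v h b e : TangentSpace 𝓘(ℝ, E) p) : TangentSpace 𝓘(ℝ, E) p :=
  ofChartAt φ p (Coord.nablaTensor (m.inChart φ)
    (Coord.T (m.inChart φ) (verticalInChart F σ φ)) (coords φ v)
    (toChart φ p h) (toChart φ p b) (toChart φ p e))

/-- The covariant derivative `(∇_h A)^v_b e`. -/
def PseudoFinslerMetric.nablaA (m : PseudoFinslerMetric E M) (F : Type*)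
    [NormedAddCommGroup F] [NormedSpace ℝ F] {B : Type*} [TopologicalSpace B] [ChartedSpace F B]
    (σ : M → B) (φ : OpenPartialHomeomorph M E) {p : M}
    (v h b e : TangentSpace 𝓘(ℝ, E) p) : TangentSpace 𝓘(ℝ, E) p :=
  ofChartAt φ p (Coord.nablaTensor (m.inChart φ)
    (Coord.A (m.inChart φ) (verticalInChart F σ φ)) (coords φ v)
    (toChart φ p h) (toChart φ p b) (toChart φ p e))

end Submersion

end Finsler

end

/-!
Everything takes place in one chart, at a vector `a = (x, v)`, and comes down to differentiating the
orthogonal projection to the vertical spaces.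

*The connection.*  The covariant derivative of an anisotropic field `𝒳` is
`∇_e 𝒳 = D𝒳(δ_e) + Γ(e, 𝒳)`, where `δ_e = (e, -Γ(e, v))` is the horizontal lift (`lift`).  The
Christoffel symbols `Γ` are symmetric (`christoffel_symm`) and metric (`fderiv_g_lift`); the latter
needs `Γ(e, v)` to be the nonlinear connection, which follows from the homogeneity of the metric in
the form `C_v(v, ·, ·) = 0` (`cartan_self`).  Differentiating twice gives the Ricci identity
`∇_b ∇_e 𝒳 - ∇_e ∇_b 𝒳 = R(b, e)𝒳 - (∂̇𝒳)(R(b, e)v)` (`ricci_identity`), for constant `b` and `e`.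

*The vertical projection.*  Let `P` be the `g_v`-orthogonal projection to the vertical space and
`Q = 1 - P`.  It depends smoothly on `(x, v)` and its covariant derivative `π_h = ∇_h P` (`dProj`)
carries all the information: `χ_h = (Q - P) π_h` (`chi_eq`).  From `P² = P` one finds that `π_h`
exchanges vertical and horizontal vectors, from `∇ g = 0` that it is self-adjoint (`g_dProj`), and
from the symmetry of the second derivative of the submersion that `π_u w = π_w u` for vertical `u`
and `w` (`dProj_symm`).  Moreover the projections at all `v` over one point fix the same vectors,
whence `(∂̇P) s = 0` for vertical `s`, while `∂̇P` has vertical values.  So the extra term in the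
Ricci identity for `P s` or `Q z` never contributes.

*The equations.*  Expanding `P ∇_b (P ∇_e (P s))` by the product rule `∇_b (P 𝒳) = π_b 𝒳 + P ∇_b 𝒳`
gives the Gauss equations `curvatureTop_eq` and `curvatureBot_eq`, which settle the components of
the curvature whose last two arguments are both vertical or both horizontal.  Expanding
`∇_b ∇_e (P s)` instead, and taking horizontal parts, shows that the second covariant derivative
`∇²P` fails to be symmetric by the curvature (`horProj_curvature`).  On the other hand `∇𝐓` and `∇𝐀`
are `∇²P` up to terms quadratic in `π` (`horProj_nablaTensor_T`, `horProj_nablaTensor_A`); comparing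
the two yields the Codazzi equations for the mixed components.
-/

section

-- Normed space structures on iterated spaces of continuous linear maps need this depth.
set_option maxSynthPendingDepth 3

namespace Finsler.Coord

/-! ### Partial derivatives -/

section Partial

variable {E : Type*} [NormedAddCommGroup E] [NormedSpace ℝ E]
  {G : Type*} [NormedAddCommGroup G] [NormedSpace ℝ G]

theorem fderiv_partial_fst {Φ : E × E → G} {a : E × E} (h : DifferentiableAt ℝ Φ a) :
    fderiv ℝ (fun x => Φ (x, a.2)) a.1 = (fderiv ℝ Φ a).comp (ContinuousLinearMap.inl ℝ E E) :=
  (HasFDerivAt.comp a.1 (f := fun x => (x, a.2)) (g := Φ) h.hasFDerivAt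
    (hasFDerivAt_prodMk_left a.1 a.2)).fderiv

theorem fderiv_partial_snd {Φ : E × E → G} {a : E × E} (h : DifferentiableAt ℝ Φ a) :
    fderiv ℝ (fun y => Φ (a.1, y)) a.2 = (fderiv ℝ Φ a).comp (ContinuousLinearMap.inr ℝ E E) :=
  (HasFDerivAt.comp a.2 (f := fun y => (a.1, y)) (g := Φ) h.hasFDerivAt
    (hasFDerivAt_prodMk_right a.1 a.2)).fderiv

theorem _root_.ContDiffOn.differentiableAt_of_isOpen {X : Type*} [NormedAddCommGroup X]
    [NormedSpace ℝ X] {Φ : X → G} {U : Set X} (h : ContDiffOn ℝ ∞ Φ U) (hU : IsOpen U) {a : X}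
    (ha : a ∈ U) : DifferentiableAt ℝ Φ a :=
  (h.contDiffAt (hU.mem_nhds ha)).differentiableAt (by simp)

theorem contDiffOn_fderiv {X : Type*} [NormedAddCommGroup X] [NormedSpace ℝ X] {Φ : X → G}
    {U : Set X} (h : ContDiffOn ℝ ∞ Φ U) (hU : IsOpen U) : ContDiffOn ℝ ∞ (fderiv ℝ Φ) U :=
  h.fderiv_of_isOpen hU (by simp)

theorem isSymmSndFDerivAt_of_isOpen {X : Type*} [NormedAddCommGroup X] [NormedSpace ℝ X]
    {Φ : X → G} {U : Set X} (h : ContDiffOn ℝ ∞ Φ U) (hU : IsOpen U) {a : X} (ha : a ∈ U) :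
    IsSymmSndFDerivAt ℝ Φ a :=
  (h.contDiffAt (hU.mem_nhds ha)).isSymmSndFDerivAt (by
    simpa using ENat.LEInfty.out)

theorem contDiffOn_partial_fst {Φ : E × E → G} {U : Set (E × E)} (h : ContDiffOn ℝ ∞ Φ U)
    (hU : IsOpen U) : ContDiffOn ℝ ∞ (fun a => fderiv ℝ (fun x => Φ (x, a.2)) a.1) U :=
  ((contDiffOn_fderiv h hU).clm_comp contDiffOn_const).congr
    fun _ ha => fderiv_partial_fst (h.differentiableAt_of_isOpen hU ha)

theorem contDiffOn_partial_snd {Φ : E × E → G} {U : Set (E × E)} (h : ContDiffOn ℝ ∞ Φ U)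
    (hU : IsOpen U) : ContDiffOn ℝ ∞ (fun a => fderiv ℝ (fun y => Φ (a.1, y)) a.2) U :=
  ((contDiffOn_fderiv h hU).clm_comp contDiffOn_const).congr
    fun _ ha => fderiv_partial_snd (h.differentiableAt_of_isOpen hU ha)

/-- Euler's rule: the derivative of a function that is homogeneous of degree `k + 1` on an open
cone is homogeneous of degree `k`. -/
theorem fderiv_homogeneous {Φ : E → G} {V : Set E} (hV : IsOpen V) (k : ℕ) {c : ℝ} (hc : 0 < c)
    (h : ∀ y ∈ V, Φ (c • y) = c ^ (k + 1) • Φ y) {y : E} (hy : y ∈ V) :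
    fderiv ℝ Φ (c • y) = c ^ k • fderiv ℝ Φ y := by
  have h1 : (fun y => Φ (c • y)) =ᶠ[nhds y] fun y => c ^ (k + 1) • Φ y := by
    filter_upwards [hV.mem_nhds hy] with z hz using h z hz
  have h2 := h1.fderiv_eq (𝕜 := ℝ)
  rw [fderiv_comp_smul, show (fun y => c ^ (k + 1) • Φ y) = c ^ (k + 1) • Φ from rfl,
    fderiv_const_smul_field, Pi.smul_apply, pow_succ', mul_smul] at h2
  exact smul_right_injective _ hc.ne' h2

end Partial

/-! ### The fundamental tensor and the Cartan tensor -/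

section Lagrangian

variable {E : Type*} [NormedAddCommGroup E] [NormedSpace ℝ E]

/-- `ℓ` is a pseudo-Finsler metric in coordinates, `U` being the set of its admissible vectors. -/
structure IsLagrangian (ℓ : E × E → ℝ) (U : Set (E × E)) : Prop where
  isOpen : IsOpen U
  contDiffOn : ContDiffOn ℝ ∞ ℓ U
  smul_mem : ∀ a ∈ U, ∀ c : ℝ, 0 < c → (a.1, c • a.2) ∈ U
  homogeneous : ∀ a ∈ U, ∀ c : ℝ, 0 < c → ℓ (a.1, c • a.2) = c ^ 2 * ℓ a
  nondegenerate : ∀ a ∈ U, ∀ e, (∀ h, g ℓ a e h = 0) → e = 0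

namespace IsLagrangian

variable {ℓ : E × E → ℝ} {U : Set (E × E)} (hℓ : IsLagrangian ℓ U)
include hℓ

theorem contDiffOn_g : ContDiffOn ℝ ∞ (g ℓ) U :=
  (contDiffOn_partial_snd (contDiffOn_partial_snd hℓ.contDiffOn hℓ.isOpen) hℓ.isOpen).const_smul
    (1 / 2 : ℝ)

theorem contDiffOn_cartan : ContDiffOn ℝ ∞ (cartan ℓ) U :=
  (contDiffOn_partial_snd hℓ.contDiffOn_g hℓ.isOpen).const_smul (1 / 2 : ℝ)

theorem contDiffOn_dg : ContDiffOn ℝ ∞ (dg ℓ) U :=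
  contDiffOn_partial_fst hℓ.contDiffOn_g hℓ.isOpen

theorem differentiableAt_g {a : E × E} (ha : a ∈ U) : DifferentiableAt ℝ (g ℓ) a :=
  hℓ.contDiffOn_g.differentiableAt_of_isOpen hℓ.isOpen ha

theorem isOpen_fiber (x : E) : IsOpen {y | (x, y) ∈ U} :=
  hℓ.isOpen.preimage (Continuous.prodMk_right x)

theorem contDiffOn_fiber (x : E) : ContDiffOn ℝ ∞ (fun y => ℓ (x, y)) {y | (x, y) ∈ U} :=
  hℓ.contDiffOn.comp (contDiff_prodMk_right x).contDiffOn fun _ hy => hy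

theorem g_symm {a : E × E} (ha : a ∈ U) (e h : E) : g ℓ a e h = g ℓ a h e := by
  have h2 := isSymmSndFDerivAt_of_isOpen (hℓ.contDiffOn_fiber a.1) (hℓ.isOpen_fiber a.1) ha e h
  simp only [g, halfHessian, FunLike.coe_smul, Pi.smul_apply, h2]

theorem eventually_mem {a : E × E} (ha : a ∈ U) : ∀ᶠ c in nhds a, c ∈ U :=
  hℓ.isOpen.mem_nhds ha

theorem fderiv_g_symm {a : E × E} (ha : a ∈ U) (d : E × E) (e h : E) :
    fderiv ℝ (g ℓ) a d e h = fderiv ℝ (g ℓ) a d h e := by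
  have hd := hℓ.differentiableAt_g ha
  have key : ∀ e h : E, fderiv ℝ (fun c => g ℓ c e h) a d = fderiv ℝ (g ℓ) a d e h := by
    intro e h
    rw [((hd.hasFDerivAt.clm_apply (hasFDerivAt_const e a)).clm_apply
      (hasFDerivAt_const h a)).fderiv]
    simp
  rw [← key e h, ← key h e]
  have : (fun c => g ℓ c e h) =ᶠ[nhds a] fun c => g ℓ c h e := by
    filter_upwards [hℓ.eventually_mem ha] with c hc using hℓ.g_symm hc e h
  rw [this.fderiv_eq]

theorem cartan_apply {a : E × E} (ha : a ∈ U) (b e h : E) :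
    cartan ℓ a b e h = (1 / 2 : ℝ) * fderiv ℝ (g ℓ) a (0, b) e h := by
  rw [cartan, fderiv_partial_snd (hℓ.differentiableAt_g ha)]
  simp

theorem dg_apply {a : E × E} (ha : a ∈ U) (b e h : E) :
    dg ℓ a b e h = fderiv ℝ (g ℓ) a (b, 0) e h := by
  rw [dg, fderiv_partial_fst (hℓ.differentiableAt_g ha)]
  simp

theorem cartan_symm_right {a : E × E} (ha : a ∈ U) (b e h : E) :
    cartan ℓ a b e h = cartan ℓ a b h e := by
  rw [hℓ.cartan_apply ha, hℓ.cartan_apply ha, hℓ.fderiv_g_symm ha]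

theorem dg_symm_right {a : E × E} (ha : a ∈ U) (b e h : E) :
    dg ℓ a b e h = dg ℓ a b h e := by
  rw [hℓ.dg_apply ha, hℓ.dg_apply ha, hℓ.fderiv_g_symm ha]

/-- The Cartan tensor is the third derivative of `ℓ` along the fibre, up to a factor. -/
theorem cartan_symm_left {a : E × E} (ha : a ∈ U) (b e h : E) :
    cartan ℓ a b e h = cartan ℓ a e b h := by
  have h1 := isSymmSndFDerivAt_of_isOpen
    (contDiffOn_fderiv (hℓ.contDiffOn_fiber a.1) (hℓ.isOpen_fiber a.1)) (hℓ.isOpen_fiber a.1) ha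
  have h2 : fderiv ℝ (fun y => g ℓ (a.1, y)) a.2
      = (1 / 2 : ℝ) • fderiv ℝ (fderiv ℝ (fderiv ℝ fun y => ℓ (a.1, y))) a.2 :=
    congrFun (fderiv_const_smul_field (1 / 2 : ℝ)) a.2
  simp only [cartan, h2, FunLike.coe_smul, Pi.smul_apply, h1 b e]

/-- By homogeneity the fundamental tensor is constant along the ray through `v`. -/
theorem cartan_self {a : E × E} (ha : a ∈ U) : cartan ℓ a a.2 = 0 := by
  have h0 : ∀ c : ℝ, 0 < c → ∀ y, (a.1, y) ∈ U → g ℓ (a.1, c • y) = g ℓ (a.1, y) := by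
    intro c hc y hy
    have h1 : ∀ y ∈ {y | (a.1, y) ∈ U}, fderiv ℝ (fun y => ℓ (a.1, y)) (c • y)
        = c ^ (0 + 1) • fderiv ℝ (fun y => ℓ (a.1, y)) y := fun y hy =>
      fderiv_homogeneous (hℓ.isOpen_fiber a.1) 1 hc
        (fun z hz => by simpa using hℓ.homogeneous (a.1, z) hz c hc) hy
    have h2 := fderiv_homogeneous (Φ := fderiv ℝ fun y => ℓ (a.1, y)) (hℓ.isOpen_fiber a.1) 0 hc
      h1 hy
    simp only [g, halfHessian, h2, pow_zero, one_smul]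
  have hd : DifferentiableAt ℝ (fun y => g ℓ (a.1, y)) a.2 :=
    DifferentiableAt.comp a.2 (g := g ℓ) (f := fun y => (a.1, y)) (hℓ.differentiableAt_g ha)
      (hasFDerivAt_prodMk_right a.1 a.2).differentiableAt
  have h1 : HasDerivAt (fun t : ℝ => g ℓ (a.1, t • a.2))
      (fderiv ℝ (fun y => g ℓ (a.1, y)) a.2 a.2) 1 := by
    have h3 : HasDerivAt (fun t : ℝ => t • a.2) a.2 1 := by
      simpa using (hasDerivAt_id (1 : ℝ)).smul_const a.2
    exact HasFDerivAt.comp_hasDerivAt_of_eq (l := fun y => g ℓ (a.1, y)) (1 : ℝ) hd.hasFDerivAt h3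
      (one_smul ℝ a.2).symm
  have h2 : HasDerivAt (fun t : ℝ => g ℓ (a.1, t • a.2)) 0 1 := by
    refine (hasDerivAt_const (1 : ℝ) (g ℓ a)).congr_of_eventuallyEq ?_
    filter_upwards [lt_mem_nhds (zero_lt_one' ℝ)] with t ht using h0 t ht a.2 ha
  rw [cartan, FunLike.coe_smul, Pi.smul_apply, h1.unique h2, smul_zero]

theorem cartan_self_mid {a : E × E} (ha : a ∈ U) (b h : E) : cartan ℓ a b a.2 h = 0 := by
  rw [hℓ.cartan_symm_left ha, hℓ.cartan_self ha]; rfl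

theorem cartan_self_right {a : E × E} (ha : a ∈ U) (b h : E) : cartan ℓ a b h a.2 = 0 := by
  rw [hℓ.cartan_symm_right ha, hℓ.cartan_self_mid ha]

variable [FiniteDimensional ℝ E]

theorem isInvertible_g {a : E × E} (ha : a ∈ U) : (g ℓ a).IsInvertible := by
  have hinj : Function.Injective (g ℓ a).toLinearMap := by
    rw [injective_iff_map_eq_zero]
    intro e he
    exact hℓ.nondegenerate a ha e fun h => by
      have : g ℓ a e = 0 := he
      simp [this]
  have hrank : Module.finrank ℝ E = Module.finrank ℝ (E →L[ℝ] ℝ) := by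
    rw [← (LinearMap.toContinuousLinearMap (𝕜 := ℝ) (E := E) (F' := ℝ)).finrank_eq]
    rw [Module.finrank_linearMap, Module.finrank_self, mul_one]
  refine ⟨(LinearEquiv.ofInjectiveOfFinrankEq (g ℓ a).toLinearMap hinj
    hrank).toContinuousLinearEquiv, ?_⟩
  ext e h
  rfl

theorem g_sharp {a : E × E} (ha : a ∈ U) (α : E →L[ℝ] ℝ) : g ℓ a (sharp ℓ a α) = α :=
  (hℓ.isInvertible_g ha).self_apply_inverse α

theorem contDiffOn_sharp : ContDiffOn ℝ ∞ (sharp ℓ) U := fun a ha =>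
  ((hℓ.isInvertible_g ha).contDiffAt_map_inverse).comp_contDiffWithinAt a (hℓ.contDiffOn_g a ha)

theorem ext_g {a : E × E} (ha : a ∈ U) {e h : E} (H : ∀ b, g ℓ a e b = g ℓ a h b) : e = h :=
  (hℓ.isInvertible_g ha).injective (ContinuousLinearMap.ext H)

end IsLagrangian
end Lagrangian

/-! ### The Levi-Civita--Chern connection -/

section Connection

variable {E : Type*} [NormedAddCommGroup E] [NormedSpace ℝ E] [FiniteDimensional ℝ E]

/-- The Christoffel symbols `Γ` as a continuous bilinear map. -/
noncomputable def christoffel (ℓ : E × E → ℝ) (a : E × E) : E →L[ℝ] E →L[ℝ] E :=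
  LinearMap.toContinuousLinearMap
    { toFun := fun e => LinearMap.toContinuousLinearMap
        { toFun := Γ ℓ a e
          map_add' := fun h k => by
            simp only [Γ, ← map_add]
            congr 1
            ext w
            simp
            ring
          map_smul' := fun r h => by
            simp only [Γ, ← map_smul, RingHom.id_apply]
            congr 1
            ext w
            simp
            ring }
      map_add' := fun e f => by
        ext h
        change Γ ℓ a (e + f) h = Γ ℓ a e h + Γ ℓ a f h
        simp only [Γ, ← map_add]
        congr 1
        ext w
        simp
        ring
      map_smul' := fun r e => by
        ext h
        change Γ ℓ a (r • e) h = r • Γ ℓ a e h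
        simp only [Γ, ← map_smul]
        congr 1
        ext w
        simp
        ring }

theorem christoffel_apply (ℓ : E × E → ℝ) (a : E × E) (e h : E) :
    christoffel ℓ a e h = Γ ℓ a e h := rfl

/-- The horizontal lift of `b ∈ T_xE` to `T_{(x, v)}(TE)` for the nonlinear connection. -/
noncomputable def lift (ℓ : E × E → ℝ) (a : E × E) : E →L[ℝ] E × E :=
  (ContinuousLinearMap.id ℝ E).prod (-(christoffel ℓ a).flip a.2)

theorem lift_apply (ℓ : E × E → ℝ) (a : E × E) (b : E) :
    lift ℓ a b = (b, -christoffel ℓ a b a.2) := rfl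

theorem nabla_eq (ℓ : E × E → ℝ) (𝒳 : E × E → E) (a : E × E) (e : E) :
    nabla ℓ 𝒳 a e = fderiv ℝ 𝒳 a (lift ℓ a e) + christoffel ℓ a e (𝒳 a) := rfl

theorem nabla_const (ℓ : E × E → ℝ) (h : E) (a : E × E) (e : E) :
    nabla ℓ (fun _ => h) a e = christoffel ℓ a e h := by
  simp [nabla_eq]

theorem nabla_congr (ℓ : E × E → ℝ) {𝒳 𝒴 : E × E → E} {a : E × E} (h : 𝒳 =ᶠ[nhds a] 𝒴) (e : E) :
    nabla ℓ 𝒳 a e = nabla ℓ 𝒴 a e := by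
  rw [nabla_eq, nabla_eq, h.fderiv_eq, h.self_of_nhds]

theorem nabla_zero_right (ℓ : E × E → ℝ) (𝒳 : E × E → E) (a : E × E) : nabla ℓ 𝒳 a 0 = 0 := by
  simp [nabla_eq]

theorem nabla_sub (ℓ : E × E → ℝ) {𝒳 𝒴 : E × E → E} {a : E × E} (hX : DifferentiableAt ℝ 𝒳 a)
    (hY : DifferentiableAt ℝ 𝒴 a) (e : E) :
    nabla ℓ (fun c => 𝒳 c - 𝒴 c) a e = nabla ℓ 𝒳 a e - nabla ℓ 𝒴 a e := by
  rw [nabla_eq, nabla_eq, nabla_eq, fderiv_fun_sub hX hY]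
  simp only [FunLike.coe_sub, Pi.sub_apply, map_sub]
  abel

omit [FiniteDimensional ℝ E] in
theorem lieBracket_const (b e : E) :
    VectorField.lieBracket ℝ (fun _ : E => b) (fun _ => e) = fun _ => 0 := by
  ext x; simp [VectorField.lieBracket]

theorem curvature_eq (ℓ : E × E → ℝ) (a : E × E) (b e h : E) :
    curvature ℓ a b e h = nabla ℓ (fun c => christoffel ℓ c e h) a b
      - nabla ℓ (fun c => christoffel ℓ c b h) a e := by
  have hc : ∀ d : E, nablaField ℓ (fun _ => d) (fun _ => h) = fun c => christoffel ℓ c d h :=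
    fun d => funext fun c => nabla_const ℓ h c d
  simp only [curvature, curvatureOp, lieBracket_const, hc]
  simp only [nablaField, map_zero, zero_apply, sub_zero]

namespace IsLagrangian

variable {ℓ : E × E → ℝ} {U : Set (E × E)} (hℓ : IsLagrangian ℓ U)
include hℓ

theorem contDiffOn_spray : ContDiffOn ℝ ∞ (spray ℓ) U := by
  have h1 := hℓ.contDiffOn_dg
  refine hℓ.contDiffOn_sharp.clm_apply (contDiffOn_clm_apply.2 fun w => ?_)
  simp only [FunLike.coe_sub, FunLike.coe_smul, Pi.sub_apply,
    Pi.smul_apply, ContinuousLinearMap.flip_apply]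
  fun_prop

theorem contDiffOn_nonlin : ContDiffOn ℝ ∞ (nonlin ℓ) U := by
  have h1 := hℓ.contDiffOn_dg
  have h2 := hℓ.contDiffOn_cartan
  have h3 := hℓ.contDiffOn_spray
  refine hℓ.contDiffOn_sharp.clm_comp (contDiffOn_clm_apply.2 fun w =>
    contDiffOn_clm_apply.2 fun z => ?_)
  simp only [FunLike.coe_sub, FunLike.coe_add, FunLike.coe_smul, Pi.sub_apply, Pi.add_apply,
    Pi.smul_apply, ContinuousLinearMap.flip_apply]
  fun_prop

theorem contDiffOn_christoffel : ContDiffOn ℝ ∞ (christoffel ℓ) U := by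
  have h1 := hℓ.contDiffOn_dg
  have h2 := hℓ.contDiffOn_cartan
  have h3 := hℓ.contDiffOn_nonlin
  refine contDiffOn_clm_apply.2 fun e => contDiffOn_clm_apply.2 fun h => ?_
  refine hℓ.contDiffOn_sharp.clm_apply (contDiffOn_clm_apply.2 fun w => ?_)
  simp only [FunLike.coe_sub, FunLike.coe_add, FunLike.coe_smul, Pi.sub_apply, Pi.add_apply,
    Pi.smul_apply, ContinuousLinearMap.flip_apply, ContinuousLinearMap.comp_apply]
  fun_prop

theorem g_christoffel {a : E × E} (ha : a ∈ U) (e h b : E) :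
    g ℓ a (christoffel ℓ a e h) b
      = 1 / 2 * (dg ℓ a e h b + dg ℓ a h e b - dg ℓ a b e h)
        - cartan ℓ a (nonlin ℓ a e) h b - cartan ℓ a (nonlin ℓ a h) e b
        + cartan ℓ a (nonlin ℓ a b) e h := by
  rw [christoffel_apply, Γ, hℓ.g_sharp ha]
  simp

theorem g_nonlin {a : E × E} (ha : a ∈ U) (e b : E) :
    g ℓ a (nonlin ℓ a e) b
      = 1 / 2 * (dg ℓ a e a.2 b + dg ℓ a a.2 e b - dg ℓ a b a.2 e)
        - cartan ℓ a (spray ℓ a) e b := by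
  rw [nonlin, ContinuousLinearMap.comp_apply, hℓ.g_sharp ha]
  simp

/-- The connection is torsion-free. -/
theorem christoffel_symm {a : E × E} (ha : a ∈ U) (e h : E) :
    christoffel ℓ a e h = christoffel ℓ a h e := by
  refine hℓ.ext_g ha fun b => ?_
  rw [hℓ.g_christoffel ha, hℓ.g_christoffel ha, hℓ.dg_symm_right ha b e h,
    hℓ.cartan_symm_right ha _ e h]
  ring

theorem nonlin_self {a : E × E} (ha : a ∈ U) : nonlin ℓ a a.2 = spray ℓ a := by
  refine hℓ.ext_g ha fun b => ?_
  rw [hℓ.g_nonlin ha, spray, hℓ.g_sharp ha, ← spray, hℓ.cartan_self_mid ha]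
  simp
  ring

theorem christoffel_self {a : E × E} (ha : a ∈ U) (e : E) :
    christoffel ℓ a e a.2 = nonlin ℓ a e := by
  refine hℓ.ext_g ha fun b => ?_
  rw [hℓ.g_christoffel ha, hℓ.g_nonlin ha, hℓ.cartan_self_mid ha, hℓ.cartan_self_right ha,
    hℓ.nonlin_self ha, hℓ.dg_symm_right ha b]
  ring

/-- The connection is metric: `∇ g = 0`. -/
theorem fderiv_g_lift {a : E × E} (ha : a ∈ U) (e h b : E) :
    fderiv ℝ (g ℓ) a (lift ℓ a e) h b
      = g ℓ a (christoffel ℓ a e h) b + g ℓ a h (christoffel ℓ a e b) := by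
  have h1 : fderiv ℝ (g ℓ) a (lift ℓ a e) h b
      = dg ℓ a e h b - 2 * cartan ℓ a (nonlin ℓ a e) h b := by
    rw [hℓ.dg_apply ha, hℓ.cartan_apply ha, lift_apply, hℓ.christoffel_self ha,
      show (e, -nonlin ℓ a e) = (e, 0) - (0, nonlin ℓ a e) by simp, map_sub]
    simp
  rw [h1, hℓ.g_symm ha h, hℓ.g_christoffel ha, hℓ.g_christoffel ha, hℓ.dg_symm_right ha e b h,
    hℓ.cartan_symm_right ha (nonlin ℓ a e) b h]
  ring

theorem differentiableAt_christoffel {a : E × E} (ha : a ∈ U) :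
    DifferentiableAt ℝ (christoffel ℓ) a :=
  hℓ.contDiffOn_christoffel.differentiableAt_of_isOpen hℓ.isOpen ha

theorem contDiffOn_lift (e : E) : ContDiffOn ℝ ∞ (fun c => lift ℓ c e) U := by
  have := hℓ.contDiffOn_christoffel
  simp only [lift_apply]
  fun_prop

theorem contDiffOn_nabla {𝒳 : E × E → E} (hX : ContDiffOn ℝ ∞ 𝒳 U) (e : E) :
    ContDiffOn ℝ ∞ (fun c => nabla ℓ 𝒳 c e) U :=
  ((contDiffOn_fderiv hX hℓ.isOpen).clm_apply (hℓ.contDiffOn_lift e)).add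
    ((hℓ.contDiffOn_christoffel.clm_apply contDiffOn_const).clm_apply hX)

omit [FiniteDimensional ℝ E] in
theorem differentiableAt {G : Type*} [NormedAddCommGroup G] [NormedSpace ℝ G] {𝒳 : E × E → G}
    (hX : ContDiffOn ℝ ∞ 𝒳 U) {a : E × E} (ha : a ∈ U) : DifferentiableAt ℝ 𝒳 a :=
  hX.differentiableAt_of_isOpen hℓ.isOpen ha

theorem nabla_christoffel {a : E × E} (ha : a ∈ U) (b e h : E) :
    nabla ℓ (fun c => christoffel ℓ c e h) a b
      = fderiv ℝ (christoffel ℓ) a (lift ℓ a b) e h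
        + christoffel ℓ a b (christoffel ℓ a e h) := by
  rw [nabla_eq, (((hℓ.differentiableAt_christoffel ha).hasFDerivAt.clm_apply
    (hasFDerivAt_const e a)).clm_apply (hasFDerivAt_const h a)).fderiv]
  simp

theorem nabla_nabla {a : E × E} (ha : a ∈ U) {𝒳 : E × E → E} (hX : ContDiffOn ℝ ∞ 𝒳 U)
    (b e : E) :
    nabla ℓ (fun c => nabla ℓ 𝒳 c e) a b
      = fderiv ℝ (fderiv ℝ 𝒳) a (lift ℓ a b) (lift ℓ a e)
        + fderiv ℝ 𝒳 a (0, christoffel ℓ a e (christoffel ℓ a b a.2)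
            - fderiv ℝ (christoffel ℓ) a (lift ℓ a b) e a.2)
        + fderiv ℝ (christoffel ℓ) a (lift ℓ a b) e (𝒳 a)
        + christoffel ℓ a e (fderiv ℝ 𝒳 a (lift ℓ a b))
        + christoffel ℓ a b (fderiv ℝ 𝒳 a (lift ℓ a e))
        + christoffel ℓ a b (christoffel ℓ a e (𝒳 a)) := by
  have hΓ := ((hℓ.differentiableAt_christoffel ha).hasFDerivAt.clm_apply (hasFDerivAt_const e a))
  have h1 : HasFDerivAt (fun c => lift ℓ c e) _ a :=
    (hasFDerivAt_const e a).prodMk (hΓ.clm_apply hasFDerivAt_snd).neg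
  have h2 := (hℓ.differentiableAt (contDiffOn_fderiv hX hℓ.isOpen) ha).hasFDerivAt.clm_apply h1
  have h3 := hΓ.clm_apply (hℓ.differentiableAt hX ha).hasFDerivAt
  have h4 : HasFDerivAt (fun c => nabla ℓ 𝒳 c e) _ a := h2.add h3
  rw [nabla_eq, h4.fderiv, nabla_eq]
  simp only [lift_apply, ContinuousLinearMap.comp_zero, zero_add, FunLike.coe_add, Pi.add_apply,
    ContinuousLinearMap.comp_apply, ContinuousLinearMap.prod_apply, ContinuousLinearMap.flip_apply,
    FunLike.coe_neg, Pi.neg_apply, ContinuousLinearMap.coe_snd', map_add]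
  simp only [map_neg, zero_apply, neg_add, neg_neg, ← sub_eq_add_neg]
  abel

/-- The Ricci identity: on anisotropic vector fields the commutator of covariant derivatives is
the curvature, corrected by the fibre derivative in the direction of the curvature of the nonlinear
connection. -/
theorem ricci_identity {a : E × E} (ha : a ∈ U) {𝒳 : E × E → E} (hX : ContDiffOn ℝ ∞ 𝒳 U)
    (b e : E) :
    nabla ℓ (fun c => nabla ℓ 𝒳 c e) a b - nabla ℓ (fun c => nabla ℓ 𝒳 c b) a e
      = curvature ℓ a b e (𝒳 a) - fderiv ℝ 𝒳 a (0, curvature ℓ a b e a.2) := by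
  rw [hℓ.nabla_nabla ha hX, hℓ.nabla_nabla ha hX, curvature_eq, curvature_eq,
    hℓ.nabla_christoffel ha, hℓ.nabla_christoffel ha, hℓ.nabla_christoffel ha,
    hℓ.nabla_christoffel ha, isSymmSndFDerivAt_of_isOpen hX hℓ.isOpen ha (lift ℓ a e) (lift ℓ a b)]
  have h0 : ∀ p q : E, ((0 : E), p - q) = ((0 : E), p) - (0, q) := by simp
  have h1 : ∀ p q : E, ((0 : E), p + q) = ((0 : E), p) + (0, q) := by simp
  simp only [h0, h1, map_sub, map_add]
  abel

end IsLagrangian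
end Connection

/-! ### The vertical projection of a submersion -/

section Projection

variable {E : Type*} [NormedAddCommGroup E] [NormedSpace ℝ E] [FiniteDimensional ℝ E]
  {F : Type*} [NormedAddCommGroup F] [NormedSpace ℝ F]

/-- `f` is a submersion in coordinates with the vertical spaces `K x = ker df_x`, which are
`g_v`-nondegenerate for the admissible vectors `v`. -/
structure IsSubmersion (ℓ : E × E → ℝ) (U : Set (E × E)) (f : E → F) (K : E → Submodule ℝ E) :
    Prop where
  contDiffAt : ∀ a ∈ U, ContDiffAt ℝ ∞ f a.1
  surjective : ∀ a ∈ U, Function.Surjective (fderiv ℝ f a.1)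
  mem_iff : ∀ a ∈ U, ∀ e, e ∈ K a.1 ↔ fderiv ℝ f a.1 e = 0
  nondegenerate : ∀ a ∈ U, ∀ u ∈ K a.1, (∀ w ∈ K a.1, g ℓ a u w = 0) → u = 0

/-- The transpose of `df_x`, pulling linear forms on `F` back to `E`. -/
noncomputable def pull (f : E → F) (a : E × E) : (F →L[ℝ] ℝ) →L[ℝ] E →L[ℝ] ℝ :=
  (ContinuousLinearMap.compL ℝ E F ℝ).flip (fderiv ℝ f a.1)

/-- The bilinear form that `g_v` induces on the linear forms on `F`, as a map `F* → F`. -/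
noncomputable def gram (ℓ : E × E → ℝ) (f : E → F) (a : E × E) : (F →L[ℝ] ℝ) →L[ℝ] F :=
  (fderiv ℝ f a.1).comp ((sharp ℓ a).comp (pull f a))

/-- The `g_v`-orthogonal projection `e ↦ e^⊥_v`.  With `S = df_x` it is
`g⁻¹ Sᵗ (S g⁻¹ Sᵗ)⁻¹ S`, which exhibits its smooth dependence on `(x, v)`. -/
noncomputable def horProj (ℓ : E × E → ℝ) (f : E → F) (a : E × E) : E →L[ℝ] E :=
  (sharp ℓ a).comp ((pull f a).comp ((gram ℓ f a).inverse.comp (fderiv ℝ f a.1)))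

/-- The `g_v`-orthogonal projection `e ↦ e^⊤_v`. -/
noncomputable def vertProj (ℓ : E × E → ℝ) (f : E → F) (a : E × E) : E →L[ℝ] E :=
  ContinuousLinearMap.id ℝ E - horProj ℓ f a

omit [FiniteDimensional ℝ E] in
theorem vertProj_apply (ℓ : E × E → ℝ) (f : E → F) (a : E × E) (e : E) :
    vertProj ℓ f a e = e - horProj ℓ f a e := rfl

omit [FiniteDimensional ℝ E] in
theorem horProj_apply (ℓ : E × E → ℝ) (f : E → F) (a : E × E) (e : E) :
    horProj ℓ f a e = e - vertProj ℓ f a e := by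
  rw [vertProj_apply]; abel

namespace IsSubmersion

variable {ℓ : E × E → ℝ} {U : Set (E × E)} {f : E → F} {K : E → Submodule ℝ E}
  (hf : IsSubmersion ℓ U f K) (hℓ : IsLagrangian ℓ U)

include hf in
omit [FiniteDimensional ℝ E] in
theorem contDiffOn_fderiv : ContDiffOn ℝ ∞ (fun a : E × E => fderiv ℝ f a.1) U := fun a ha =>
  (((hf.contDiffAt a ha).fderiv_right (m := ∞) (by simp)).comp a contDiffAt_fst).contDiffWithinAt

variable [FiniteDimensional ℝ F]
include hf hℓ

theorem isInvertible_gram {a : E × E} (ha : a ∈ U) : (gram ℓ f a).IsInvertible := by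
  have hinj : Function.Injective (gram ℓ f a).toLinearMap := by
    rw [injective_iff_map_eq_zero]
    intro α hα
    -- `g⁻¹ Sᵗ α` is vertical and orthogonal to all vertical vectors
    have h1 : sharp ℓ a (pull f a α) = 0 := by
      refine hf.nondegenerate a ha _ ((hf.mem_iff a ha _).2 hα) fun w hw => ?_
      rw [hℓ.g_sharp ha]
      change α (fderiv ℝ f a.1 w) = 0
      rw [(hf.mem_iff a ha w).1 hw, map_zero]
    have h2 : pull f a α = 0 := by rw [← hℓ.g_sharp ha (pull f a α), h1, map_zero]
    ext y
    obtain ⟨e, rfl⟩ := hf.surjective a ha y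
    exact DFunLike.congr_fun h2 e
  have hrank : Module.finrank ℝ (F →L[ℝ] ℝ) = Module.finrank ℝ F := by
    rw [← (LinearMap.toContinuousLinearMap (𝕜 := ℝ) (E := F) (F' := ℝ)).finrank_eq,
      Module.finrank_linearMap, Module.finrank_self, mul_one]
  exact ⟨(LinearEquiv.ofInjectiveOfFinrankEq (gram ℓ f a).toLinearMap hinj
    hrank).toContinuousLinearEquiv, by ext; rfl⟩

theorem contDiffOn_horProj : ContDiffOn ℝ ∞ (horProj ℓ f) U := by
  have h1 := hf.contDiffOn_fderiv
  have h2 := hℓ.contDiffOn_sharp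
  have h3 : ContDiffOn ℝ ∞ (pull f) U :=
    (ContinuousLinearMap.contDiff (ContinuousLinearMap.compL ℝ E F ℝ).flip).comp_contDiffOn h1
  have h4 : ContDiffOn ℝ ∞ (gram ℓ f) U := h1.clm_comp (h2.clm_comp h3)
  have h5 : ContDiffOn ℝ ∞ (fun a => (gram ℓ f a).inverse) U := fun a ha =>
    ((hf.isInvertible_gram hℓ ha).contDiffAt_map_inverse).comp_contDiffWithinAt a (h4 a ha)
  exact h2.clm_comp (h3.clm_comp (h5.clm_comp h1))

theorem contDiffOn_vertProj : ContDiffOn ℝ ∞ (vertProj ℓ f) U :=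
  contDiffOn_const.sub (hf.contDiffOn_horProj hℓ)

omit [FiniteDimensional ℝ F] in
theorem g_horProj_of_mem {a : E × E} (ha : a ∈ U) (e : E) {w : E} (hw : w ∈ K a.1) :
    g ℓ a (horProj ℓ f a e) w = 0 := by
  rw [horProj, ContinuousLinearMap.comp_apply, hℓ.g_sharp ha]
  change (gram ℓ f a).inverse (fderiv ℝ f a.1 e) (fderiv ℝ f a.1 w) = 0
  rw [(hf.mem_iff a ha w).1 hw, map_zero]

theorem vertProj_mem {a : E × E} (ha : a ∈ U) (e : E) : vertProj ℓ f a e ∈ K a.1 := by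
  rw [hf.mem_iff a ha, vertProj_apply, map_sub, sub_eq_zero]
  exact ((hf.isInvertible_gram hℓ ha).self_apply_inverse (fderiv ℝ f a.1 e)).symm

omit hℓ [FiniteDimensional ℝ E] [FiniteDimensional ℝ F] in
theorem vertProj_of_mem {a : E × E} (ha : a ∈ U) {u : E} (hu : u ∈ K a.1) :
    vertProj ℓ f a u = u := by
  rw [vertProj_apply, horProj]
  simp [(hf.mem_iff a ha u).1 hu]

theorem vertProj_vertProj {a : E × E} (ha : a ∈ U) (e : E) :
    vertProj ℓ f a (vertProj ℓ f a e) = vertProj ℓ f a e :=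
  hf.vertProj_of_mem ha (hf.vertProj_mem hℓ ha e)

theorem horProj_vertProj {a : E × E} (ha : a ∈ U) (e : E) :
    horProj ℓ f a (vertProj ℓ f a e) = 0 := by
  rw [horProj_apply, hf.vertProj_vertProj hℓ ha, sub_self]

theorem g_vertProj_left {a : E × E} (ha : a ∈ U) (e h : E) :
    g ℓ a (vertProj ℓ f a e) h = g ℓ a (vertProj ℓ f a e) (vertProj ℓ f a h) := by
  rw [vertProj_apply ℓ f a h, map_sub, hℓ.g_symm ha _ (horProj ℓ f a h),
    hf.g_horProj_of_mem hℓ ha _ (hf.vertProj_mem hℓ ha e), sub_zero]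

/-- The vertical projection is self-adjoint. -/
theorem g_vertProj {a : E × E} (ha : a ∈ U) (e h : E) :
    g ℓ a (vertProj ℓ f a e) h = g ℓ a e (vertProj ℓ f a h) := by
  rw [hf.g_vertProj_left hℓ ha, hℓ.g_symm ha e, hf.g_vertProj_left hℓ ha h, hℓ.g_symm ha]

theorem vertProj_eq_zero_iff {a : E × E} (ha : a ∈ U) (e : E) :
    vertProj ℓ f a e = 0 ↔ ∀ w ∈ K a.1, g ℓ a e w = 0 := by
  constructor
  · intro h w hw
    rw [← hf.vertProj_of_mem ha hw, ← hf.g_vertProj hℓ ha, h, map_zero, zero_apply]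
  · intro h
    refine hf.nondegenerate a ha _ (hf.vertProj_mem hℓ ha e) fun w hw => ?_
    rw [hf.g_vertProj hℓ ha]
    exact h _ (hf.vertProj_mem hℓ ha w)

theorem isCompl {a : E × E} (ha : a ∈ U) : IsCompl (K a.1) (orthSpace ℓ K a) := by
  constructor
  · rw [Submodule.disjoint_def]
    exact fun u hu hu' => hf.nondegenerate a ha u hu hu'
  · rw [codisjoint_iff, Submodule.eq_top_iff']
    intro e
    refine Submodule.mem_sup.2 ⟨_, hf.vertProj_mem hℓ ha e, horProj ℓ f a e,
      fun w hw => hf.g_horProj_of_mem hℓ ha e hw, ?_⟩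
    rw [vertProj_apply]; abel

theorem top_eq {a : E × E} (ha : a ∈ U) (e : E) : top ℓ K a e = vertProj ℓ f a e := by
  have hc := hf.isCompl hℓ ha
  rw [top, dif_pos hc]
  conv_lhs => rw [show e = vertProj ℓ f a e + horProj ℓ f a e by rw [vertProj_apply]; abel]
  rw [map_add]
  have h1 := Submodule.projection_apply_of_mem_left hc (hf.vertProj_mem hℓ ha e)
  have h2 := (Submodule.projection_apply_eq_zero_iff hc (x := horProj ℓ f a e)).2
    fun w hw => hf.g_horProj_of_mem hℓ ha e hw
  rw [h1, h2, add_zero]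

theorem bot_eq {a : E × E} (ha : a ∈ U) (e : E) : bot ℓ K a e = horProj ℓ f a e := by
  rw [bot, hf.top_eq hℓ ha, horProj_apply]

theorem topField_eventuallyEq {a : E × E} (ha : a ∈ U) (𝒳 : E × E → E) :
    topField ℓ K 𝒳 =ᶠ[nhds a] fun c => vertProj ℓ f c (𝒳 c) := by
  filter_upwards [hℓ.eventually_mem ha] with c hc using hf.top_eq hℓ hc _

theorem botField_eventuallyEq {a : E × E} (ha : a ∈ U) (𝒳 : E × E → E) :
    botField ℓ K 𝒳 =ᶠ[nhds a] fun c => horProj ℓ f c (𝒳 c) := by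
  filter_upwards [hℓ.eventually_mem ha] with c hc using hf.bot_eq hℓ hc _

end IsSubmersion
end Projection

/-! ### The covariant derivative of the vertical projection -/

section DProj

variable {E : Type*} [NormedAddCommGroup E] [NormedSpace ℝ E] [FiniteDimensional ℝ E]
  {F : Type*} [NormedAddCommGroup F] [NormedSpace ℝ F]

/-- The covariant derivative `π_h = ∇_h P` of the vertical projection `P`, that is
`(∂_h P) + [Γ_h, P]`, with `∂_h` the derivative along the horizontal lift of `h`. -/
noncomputable def dProj (ℓ : E × E → ℝ) (f : E → F) (a : E × E) : E →L[ℝ] E →L[ℝ] E :=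
  (fderiv ℝ (vertProj ℓ f) a).comp (lift ℓ a)
    + ((ContinuousLinearMap.compL ℝ E E E).flip (vertProj ℓ f a)).comp (christoffel ℓ a)
    - (ContinuousLinearMap.compL ℝ E E E (vertProj ℓ f a)).comp (christoffel ℓ a)

theorem dProj_apply (ℓ : E × E → ℝ) (f : E → F) (a : E × E) (h e : E) :
    dProj ℓ f a h e = fderiv ℝ (vertProj ℓ f) a (lift ℓ a h) e
      + christoffel ℓ a h (vertProj ℓ f a e) - vertProj ℓ f a (christoffel ℓ a h e) := rfl

/-- The second covariant derivative `(∇_h π)_b = ∇²_{h, b} P` of the vertical projection. -/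
noncomputable def ddProj (ℓ : E × E → ℝ) (f : E → F) (a : E × E) (h b e : E) : E :=
  fderiv ℝ (dProj ℓ f) a (lift ℓ a h) b e + christoffel ℓ a h (dProj ℓ f a b e)
    - dProj ℓ f a (christoffel ℓ a h b) e - dProj ℓ f a b (christoffel ℓ a h e)

namespace IsSubmersion

variable {ℓ : E × E → ℝ} {U : Set (E × E)} {f : E → F} {K : E → Submodule ℝ E}
  [FiniteDimensional ℝ F] (hf : IsSubmersion ℓ U f K) (hℓ : IsLagrangian ℓ U)
include hf hℓ

theorem differentiableAt_vertProj {a : E × E} (ha : a ∈ U) :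
    DifferentiableAt ℝ (vertProj ℓ f) a :=
  hℓ.differentiableAt (hf.contDiffOn_vertProj hℓ) ha

theorem contDiffOn_dProj : ContDiffOn ℝ ∞ (dProj ℓ f) U := by
  have h1 := hf.contDiffOn_vertProj hℓ
  have h2 := hℓ.contDiffOn_christoffel
  have h3 := Coord.contDiffOn_fderiv h1 hℓ.isOpen
  refine contDiffOn_clm_apply.2 fun h => contDiffOn_clm_apply.2 fun e => ?_
  have h4 := hℓ.contDiffOn_lift h
  simp only [dProj_apply]
  fun_prop

theorem differentiableAt_dProj {a : E × E} (ha : a ∈ U) : DifferentiableAt ℝ (dProj ℓ f) a :=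
  hℓ.differentiableAt (hf.contDiffOn_dProj hℓ) ha

/-- The product rule `∇_b (P 𝒳) = π_b 𝒳 + P ∇_b 𝒳`. -/
theorem nabla_vertProj {a : E × E} (ha : a ∈ U) {𝒳 : E × E → E} (hX : DifferentiableAt ℝ 𝒳 a)
    (b : E) :
    nabla ℓ (fun c => vertProj ℓ f c (𝒳 c)) a b
      = dProj ℓ f a b (𝒳 a) + vertProj ℓ f a (nabla ℓ 𝒳 a b) := by
  rw [nabla_eq, nabla_eq, ((hf.differentiableAt_vertProj hℓ ha).hasFDerivAt.clm_apply
    hX.hasFDerivAt).fderiv, dProj_apply]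
  simp only [FunLike.coe_add, Pi.add_apply, ContinuousLinearMap.comp_apply,
    ContinuousLinearMap.flip_apply, map_add]
  abel

theorem differentiableAt_vertProj_apply {a : E × E} (ha : a ∈ U) {𝒳 : E × E → E}
    (hX : DifferentiableAt ℝ 𝒳 a) : DifferentiableAt ℝ (fun c => vertProj ℓ f c (𝒳 c)) a :=
  (hf.differentiableAt_vertProj hℓ ha).clm_apply hX

theorem nabla_horProj {a : E × E} (ha : a ∈ U) {𝒳 : E × E → E} (hX : DifferentiableAt ℝ 𝒳 a)
    (b : E) :
    nabla ℓ (fun c => horProj ℓ f c (𝒳 c)) a b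
      = horProj ℓ f a (nabla ℓ 𝒳 a b) - dProj ℓ f a b (𝒳 a) := by
  simp only [horProj_apply]
  rw [nabla_sub ℓ hX (hf.differentiableAt_vertProj_apply hℓ ha hX), hf.nabla_vertProj hℓ ha hX]
  abel

theorem nabla_dProj {a : E × E} (ha : a ∈ U) {𝒳 : E × E → E} (hX : DifferentiableAt ℝ 𝒳 a)
    (h e : E) :
    nabla ℓ (fun c => dProj ℓ f c (𝒳 c) e) a h
      = ddProj ℓ f a h (𝒳 a) e + dProj ℓ f a (nabla ℓ 𝒳 a h) e
        + dProj ℓ f a (𝒳 a) (christoffel ℓ a h e) := by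
  rw [nabla_eq, nabla_eq, (((hf.differentiableAt_dProj hℓ ha).hasFDerivAt.clm_apply
    hX.hasFDerivAt).clm_apply (hasFDerivAt_const e a)).fderiv, ddProj]
  simp only [ContinuousLinearMap.comp_zero, zero_add, FunLike.coe_add, Pi.add_apply,
    ContinuousLinearMap.comp_apply, ContinuousLinearMap.flip_apply, map_add]
  abel

theorem fderiv_vertProj_idem {a : E × E} (ha : a ∈ U) (d : E × E) (e : E) :
    fderiv ℝ (vertProj ℓ f) a d (vertProj ℓ f a e) + vertProj ℓ f a (fderiv ℝ (vertProj ℓ f) a d e)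
      = fderiv ℝ (vertProj ℓ f) a d e := by
  have hd := (hf.differentiableAt_vertProj hℓ ha).hasFDerivAt
  have h1 := hd.clm_apply (hasFDerivAt_const e a)
  have h2 := (hd.clm_apply h1).congr_of_eventuallyEq
    (f₁ := fun c => vertProj ℓ f c e) (by
      filter_upwards [hℓ.eventually_mem ha] with c hc using (hf.vertProj_vertProj hℓ hc e).symm)
  have h3 := DFunLike.congr_fun (h1.unique h2) d
  simp only [ContinuousLinearMap.comp_zero, zero_add, FunLike.coe_add, Pi.add_apply,
    ContinuousLinearMap.comp_apply, ContinuousLinearMap.flip_apply] at h3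
  rw [add_comm]
  exact h3.symm

/-- The projections `P_v` for `v` in one tangent space fix the same vertical vectors. -/
theorem fderiv_vertProj_fiber_of_mem {a : E × E} (ha : a ∈ U) (η : E) {s : E} (hs : s ∈ K a.1) :
    fderiv ℝ (vertProj ℓ f) a (0, η) s = 0 := by
  have hd := hf.differentiableAt_vertProj hℓ ha
  have h1 : fderiv ℝ (fun y => vertProj ℓ f (a.1, y) s) a.2 η
      = fderiv ℝ (vertProj ℓ f) a (0, η) s := by
    rw [fderiv_partial_snd (Φ := fun c => vertProj ℓ f c s) (a := a)
      (hd.clm_apply (differentiableAt_const s)),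
      (hd.hasFDerivAt.clm_apply (hasFDerivAt_const s a)).fderiv]
    simp
  have h2 : (fun y => vertProj ℓ f (a.1, y) s) =ᶠ[nhds a.2] fun _ => s := by
    filter_upwards [(hℓ.isOpen_fiber a.1).mem_nhds ha] with y hy
      using hf.vertProj_of_mem hy hs
  rw [← h1, h2.fderiv_eq]
  simp

/-- The fibre derivative of the vertical projection has vertical values. -/
theorem horProj_fderiv_vertProj_fiber {a : E × E} (ha : a ∈ U) (η e : E) :
    horProj ℓ f a (fderiv ℝ (vertProj ℓ f) a (0, η) e) = 0 := by
  have h1 := hf.fderiv_vertProj_idem hℓ ha (0, η) e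
  rw [hf.fderiv_vertProj_fiber_of_mem hℓ ha η (hf.vertProj_mem hℓ ha e), zero_add] at h1
  rw [horProj_apply, h1, sub_self]

/-- The covariant derivative of `P² = P`. -/
theorem dProj_idem {a : E × E} (ha : a ∈ U) (h e : E) :
    dProj ℓ f a h (vertProj ℓ f a e) + vertProj ℓ f a (dProj ℓ f a h e) = dProj ℓ f a h e := by
  have h1 := hf.fderiv_vertProj_idem hℓ ha (lift ℓ a h) e
  simp only [dProj_apply, map_sub, map_add, hf.vertProj_vertProj hℓ ha]
  conv_rhs => rw [← h1]
  abel

/-- `π` maps vertical vectors to horizontal ones. -/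
theorem vertProj_dProj_of_mem {a : E × E} (ha : a ∈ U) (h : E) {s : E} (hs : s ∈ K a.1) :
    vertProj ℓ f a (dProj ℓ f a h s) = 0 := by
  have h1 := hf.dProj_idem hℓ ha h s
  rw [hf.vertProj_of_mem ha hs] at h1
  exact add_eq_left.1 h1

/-- `π` maps horizontal vectors to vertical ones. -/
theorem vertProj_dProj_of_hor {a : E × E} (ha : a ∈ U) (h : E) {z : E}
    (hz : vertProj ℓ f a z = 0) : vertProj ℓ f a (dProj ℓ f a h z) = dProj ℓ f a h z := by
  have h1 := hf.dProj_idem hℓ ha h z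
  rwa [hz, map_zero, zero_add] at h1

theorem horProj_dProj_of_mem {a : E × E} (ha : a ∈ U) (h : E) {s : E} (hs : s ∈ K a.1) :
    horProj ℓ f a (dProj ℓ f a h s) = dProj ℓ f a h s := by
  rw [horProj_apply, hf.vertProj_dProj_of_mem hℓ ha h hs, sub_zero]

theorem horProj_dProj_of_hor {a : E × E} (ha : a ∈ U) (h : E) {z : E}
    (hz : vertProj ℓ f a z = 0) : horProj ℓ f a (dProj ℓ f a h z) = 0 := by
  rw [horProj_apply, hf.vertProj_dProj_of_hor hℓ ha h hz, sub_self]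

theorem dProj_mem {a : E × E} (ha : a ∈ U) (h : E) {z : E} (hz : vertProj ℓ f a z = 0) :
    dProj ℓ f a h z ∈ K a.1 := by
  rw [← hf.vertProj_dProj_of_hor hℓ ha h hz]
  exact hf.vertProj_mem hℓ ha _

/-- `π` is self-adjoint, because `P` is and `∇ g = 0`. -/
theorem g_dProj {a : E × E} (ha : a ∈ U) (h e k : E) :
    g ℓ a (dProj ℓ f a h e) k = g ℓ a e (dProj ℓ f a h k) := by
  have hg := (hℓ.differentiableAt_g ha).hasFDerivAt
  have hd := (hf.differentiableAt_vertProj hℓ ha).hasFDerivAt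
  have h1 := (hg.clm_apply (hd.clm_apply (hasFDerivAt_const e a))).clm_apply
    (hasFDerivAt_const k a)
  have h2 := ((hg.clm_apply (hasFDerivAt_const e a)).clm_apply
    (hd.clm_apply (hasFDerivAt_const k a))).congr_of_eventuallyEq
    (f₁ := fun c => g ℓ c (vertProj ℓ f c e) k) (by
      filter_upwards [hℓ.eventually_mem ha] with c hc using hf.g_vertProj hℓ hc e k)
  have h3 := DFunLike.congr_fun (h1.unique h2) (lift ℓ a h)
  simp only [ContinuousLinearMap.comp_zero, zero_add, FunLike.coe_add, Pi.add_apply,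
    ContinuousLinearMap.comp_apply, ContinuousLinearMap.flip_apply, hℓ.fderiv_g_lift ha] at h3
  have h4 := hf.g_vertProj hℓ ha e (christoffel ℓ a h k)
  have h5 := hf.g_vertProj hℓ ha (christoffel ℓ a h e) k
  simp only [dProj_apply, map_add, map_sub, FunLike.coe_add, Pi.add_apply, FunLike.coe_sub,
    Pi.sub_apply]
  linarith

/-- The vertical distribution is integrable: `df(P u) = 0` is differentiated along the horizontal
lifts, and the second derivative of `f` is symmetric. -/
theorem dProj_symm {a : E × E} (ha : a ∈ U) {u w : E} (hu : u ∈ K a.1) (hw : w ∈ K a.1) :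
    dProj ℓ f a u w = dProj ℓ f a w u := by
  have hd := (hf.differentiableAt_vertProj hℓ ha).hasFDerivAt
  have hS : HasFDerivAt (fun c : E × E => fderiv ℝ f c.1)
      ((fderiv ℝ (fderiv ℝ f) a.1).comp (ContinuousLinearMap.fst ℝ E E)) a :=
    (((hf.contDiffAt a ha).fderiv_right (m := ∞) (by simp)).differentiableAt
      (by simp)).hasFDerivAt.comp a hasFDerivAt_fst
  have key : ∀ b e : E, e ∈ K a.1 → fderiv ℝ f a.1 (fderiv ℝ (vertProj ℓ f) a (lift ℓ a b) e)
      = -fderiv ℝ (fderiv ℝ f) a.1 b e := by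
    intro b e he
    have h1 := hS.clm_apply (hd.clm_apply (hasFDerivAt_const e a))
    have h2 := (hasFDerivAt_const (𝕜 := ℝ) (0 : F) a).congr_of_eventuallyEq
      (f₁ := fun c => fderiv ℝ f c.1 (vertProj ℓ f c e)) (by
        filter_upwards [hℓ.eventually_mem ha] with c hc
          using (hf.mem_iff c hc _).1 (hf.vertProj_mem hℓ hc e))
    have h3 := DFunLike.congr_fun (h1.unique h2) (lift ℓ a b)
    simp only [ContinuousLinearMap.comp_zero, zero_add, FunLike.coe_add, Pi.add_apply,
      ContinuousLinearMap.comp_apply, ContinuousLinearMap.flip_apply, zero_apply,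
      ContinuousLinearMap.coe_fst', lift_apply, hf.vertProj_of_mem ha he] at h3
    exact eq_neg_of_add_eq_zero_left h3
  have hsym : IsSymmSndFDerivAt ℝ f a.1 :=
    (hf.contDiffAt a ha).isSymmSndFDerivAt (by simpa using ENat.LEInfty.out)
  have h1 : fderiv ℝ (vertProj ℓ f) a (lift ℓ a u) w - fderiv ℝ (vertProj ℓ f) a (lift ℓ a w) u
      ∈ K a.1 := by
    rw [hf.mem_iff a ha, map_sub, key u w hw, key w u hu, hsym u w, sub_self]
  have h2 : dProj ℓ f a u w - dProj ℓ f a w u = fderiv ℝ (vertProj ℓ f) a (lift ℓ a u) w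
      - fderiv ℝ (vertProj ℓ f) a (lift ℓ a w) u := by
    rw [dProj_apply, dProj_apply, hf.vertProj_of_mem ha hu, hf.vertProj_of_mem ha hw,
      hℓ.christoffel_symm ha u w]
    abel
  rw [← h2] at h1
  rw [← sub_eq_zero, ← hf.vertProj_of_mem (ℓ := ℓ) ha h1, map_sub,
    hf.vertProj_dProj_of_mem hℓ ha u hw, hf.vertProj_dProj_of_mem hℓ ha w hu, sub_self]

end IsSubmersion
end DProj

/-! ### The fundamental equations in coordinates -/

namespace IsSubmersion

variable {E : Type*} [NormedAddCommGroup E] [NormedSpace ℝ E] [FiniteDimensional ℝ E]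
  {F : Type*} [NormedAddCommGroup F] [NormedSpace ℝ F] [FiniteDimensional ℝ F]
  {ℓ : E × E → ℝ} {U : Set (E × E)} {f : E → F} {K : E → Submodule ℝ E}
  (hf : IsSubmersion ℓ U f K) (hℓ : IsLagrangian ℓ U)
include hf hℓ

/-- `χ_h = (Q - P) ∘ π_h`, where `Q = 1 - P` is the horizontal projection. -/
theorem chi_eq {a : E × E} (ha : a ∈ U) (h e : E) :
    chi ℓ K a h e = dProj ℓ f a h e - (2 : ℝ) • vertProj ℓ f a (dProj ℓ f a h e) := by
  have he := differentiableAt_const (𝕜 := ℝ) e (x := a)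
  rw [chi, hf.top_eq hℓ ha, hf.bot_eq hℓ ha,
    nabla_congr ℓ (hf.botField_eventuallyEq hℓ ha fun _ => e),
    nabla_congr ℓ (hf.topField_eventuallyEq hℓ ha fun _ => e),
    hf.nabla_vertProj hℓ ha he, hf.nabla_horProj hℓ ha he]
  simp only [horProj_apply, map_sub, map_add, hf.vertProj_vertProj hℓ ha, two_smul]
  abel

theorem chi_of_mem {a : E × E} (ha : a ∈ U) (h : E) {s : E} (hs : s ∈ K a.1) :
    chi ℓ K a h s = dProj ℓ f a h s := by
  rw [hf.chi_eq hℓ ha, hf.vertProj_dProj_of_mem hℓ ha h hs, smul_zero, sub_zero]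

theorem chi_of_hor {a : E × E} (ha : a ∈ U) (h : E) {z : E} (hz : vertProj ℓ f a z = 0) :
    chi ℓ K a h z = -dProj ℓ f a h z := by
  rw [hf.chi_eq hℓ ha, hf.vertProj_dProj_of_hor hℓ ha h hz, two_smul]
  abel

theorem T_eq {a : E × E} (ha : a ∈ U) {b : E} (hb : b ∈ K a.1) (e : E) :
    T ℓ K a b e = chi ℓ K a b e := by
  rw [T, hf.top_eq hℓ ha, hf.vertProj_of_mem ha hb]

theorem A_eq {a : E × E} (ha : a ∈ U) {b : E} (hb : vertProj ℓ f a b = 0) (e : E) :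
    A ℓ K a b e = chi ℓ K a b e := by
  rw [A, hf.bot_eq hℓ ha, horProj_apply, hb, sub_zero]

theorem horProj_chi {a : E × E} (ha : a ∈ U) (h e : E) :
    horProj ℓ f a (chi ℓ K a h e) = horProj ℓ f a (dProj ℓ f a h e) := by
  rw [hf.chi_eq hℓ ha, map_sub, map_smul, hf.horProj_vertProj hℓ ha, smul_zero, sub_zero]

/-- The horizontal part of `∇_h (χ_ℬ e)`, for an anisotropic vector field `ℬ`, a constant vector
field `e` and a point where `e` is vertical. -/
theorem horProj_nabla_chi {a : E × E} (ha : a ∈ U) {ℬ : E × E → E} (hB : DifferentiableAt ℝ ℬ a)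
    (h : E) {e : E} (he : e ∈ K a.1) :
    horProj ℓ f a (nabla ℓ (fun c => chi ℓ K c (ℬ c) e) a h)
      = horProj ℓ f a (ddProj ℓ f a h (ℬ a) e) + dProj ℓ f a (nabla ℓ ℬ a h) e
        + horProj ℓ f a (dProj ℓ f a (ℬ a) (christoffel ℓ a h e)) := by
  have hY : DifferentiableAt ℝ (fun c => dProj ℓ f c (ℬ c) e) a :=
    ((hf.differentiableAt_dProj hℓ ha).clm_apply hB).clm_apply (differentiableAt_const e)
  have hPY := hf.differentiableAt_vertProj_apply hℓ ha hY
  have h1 : (fun c => chi ℓ K c (ℬ c) e) =ᶠ[nhds a] fun c => dProj ℓ f c (ℬ c) e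
      - (2 : ℝ) • vertProj ℓ f c (dProj ℓ f c (ℬ c) e) := by
    filter_upwards [hℓ.eventually_mem ha] with c hc using hf.chi_eq hℓ hc _ _
  have h2 : nabla ℓ (fun c => (2 : ℝ) • vertProj ℓ f c (dProj ℓ f c (ℬ c) e)) a h
      = (2 : ℝ) • nabla ℓ (fun c => vertProj ℓ f c (dProj ℓ f c (ℬ c) e)) a h := by
    rw [nabla_eq, nabla_eq, fderiv_fun_const_smul hPY]
    simp
  rw [nabla_congr ℓ h1, nabla_sub ℓ hY (hPY.fun_const_smul (2 : ℝ)), h2, hf.nabla_vertProj hℓ ha hY,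
    map_sub, map_smul, map_add, hf.horProj_vertProj hℓ ha,
    hf.horProj_dProj_of_hor hℓ ha h (hf.vertProj_dProj_of_mem hℓ ha (ℬ a) he), add_zero, smul_zero,
    sub_zero, hf.nabla_dProj hℓ ha hB, map_add, map_add, hf.horProj_dProj_of_mem hℓ ha _ he]

theorem horProj_nablaTensor_T {a : E × E} (ha : a ∈ U) (h : E) {b e : E} (hb : b ∈ K a.1)
    (he : e ∈ K a.1) :
    horProj ℓ f a (nablaTensor ℓ (T ℓ K) a h b e)
      = horProj ℓ f a (ddProj ℓ f a h b e) + dProj ℓ f a (dProj ℓ f a h b) e := by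
  have hB := differentiableAt_const (𝕜 := ℝ) b (x := a)
  have h1 : (fun c => T ℓ K c b e) =ᶠ[nhds a] fun c => chi ℓ K c (vertProj ℓ f c b) e := by
    filter_upwards [hℓ.eventually_mem ha] with c hc
    rw [T, hf.top_eq hℓ hc]
  rw [nablaTensor, nabla_congr ℓ h1, map_sub, map_sub,
    hf.horProj_nabla_chi hℓ ha (hf.differentiableAt_vertProj_apply hℓ ha hB) h he,
    hf.nabla_vertProj hℓ ha hB, nabla_const, nabla_const, T, T, hf.horProj_chi hℓ ha,
    hf.horProj_chi hℓ ha, hf.top_eq hℓ ha, hf.top_eq hℓ ha, hf.vertProj_of_mem ha hb,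
    hf.horProj_dProj_of_mem hℓ ha _ he, map_add, FunLike.coe_add, Pi.add_apply]
  abel

theorem horProj_nablaTensor_A {a : E × E} (ha : a ∈ U) (h : E) {b e : E}
    (hb : vertProj ℓ f a b = 0) (he : e ∈ K a.1) :
    horProj ℓ f a (nablaTensor ℓ (A ℓ K) a h b e)
      = horProj ℓ f a (ddProj ℓ f a h b e) - dProj ℓ f a (dProj ℓ f a h b) e := by
  have hB := differentiableAt_const (𝕜 := ℝ) b (x := a)
  have h1 : (fun c => A ℓ K c b e) =ᶠ[nhds a] fun c => chi ℓ K c (horProj ℓ f c b) e := by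
    filter_upwards [hℓ.eventually_mem ha] with c hc
    rw [A, hf.bot_eq hℓ hc]
  have h2 : DifferentiableAt ℝ (fun c => horProj ℓ f c b) a :=
    (hℓ.differentiableAt (hf.contDiffOn_horProj hℓ) ha).clm_apply hB
  have h3 : horProj ℓ f a b = b := by rw [horProj_apply, hb, sub_zero]
  rw [nablaTensor, nabla_congr ℓ h1, map_sub, map_sub,
    hf.horProj_nabla_chi hℓ ha h2 h he,
    hf.nabla_horProj hℓ ha hB, nabla_const, nabla_const, A, A, hf.horProj_chi hℓ ha,
    hf.horProj_chi hℓ ha, hf.bot_eq hℓ ha, hf.bot_eq hℓ ha, h3,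
    hf.horProj_dProj_of_mem hℓ ha _ he, map_sub, FunLike.coe_sub, Pi.sub_apply]
  abel

theorem contDiffOn_vertProj_const (s : E) : ContDiffOn ℝ ∞ (fun c => vertProj ℓ f c s) U :=
  (hf.contDiffOn_vertProj hℓ).clm_apply contDiffOn_const

theorem contDiffOn_horProj_const (s : E) : ContDiffOn ℝ ∞ (fun c => horProj ℓ f c s) U :=
  (hf.contDiffOn_horProj hℓ).clm_apply contDiffOn_const

/-- On a vertical vector `s` the Ricci identity for the anisotropic field `P s` has no fibre
derivative term. -/
theorem ricci_vertProj {a : E × E} (ha : a ∈ U) (b e : E) {s : E} (hs : s ∈ K a.1) :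
    nabla ℓ (fun c => nabla ℓ (fun d => vertProj ℓ f d s) c e) a b
      - nabla ℓ (fun c => nabla ℓ (fun d => vertProj ℓ f d s) c b) a e = curvature ℓ a b e s := by
  rw [hℓ.ricci_identity ha (hf.contDiffOn_vertProj_const hℓ s), hf.vertProj_of_mem ha hs,
    ((hf.differentiableAt_vertProj hℓ ha).hasFDerivAt.clm_apply (hasFDerivAt_const s a)).fderiv]
  simp [hf.fderiv_vertProj_fiber_of_mem hℓ ha _ hs]

/-- The second covariant derivative of the vertical projection fails to be symmetric by the
curvature. -/
theorem horProj_curvature {a : E × E} (ha : a ∈ U) (b e : E) {s : E} (hs : s ∈ K a.1) :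
    horProj ℓ f a (curvature ℓ a b e s)
      = horProj ℓ f a (ddProj ℓ f a b e s) - horProj ℓ f a (ddProj ℓ f a e b s) := by
  have key : ∀ b e : E, horProj ℓ f a (nabla ℓ (fun c => nabla ℓ (fun d => vertProj ℓ f d s) c e)
      a b) = horProj ℓ f a (ddProj ℓ f a b e s) + horProj ℓ f a (dProj ℓ f a (christoffel ℓ a b e) s
        + dProj ℓ f a e (christoffel ℓ a b s) + dProj ℓ f a b (christoffel ℓ a e s)) := by
    intro b e
    -- `∇_e (P s) = π_e s + P (Γ(e, s))`, and the second summand of `∇_b (P (Γ(e, s)))` is vertical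
    have hY : DifferentiableAt ℝ (fun c => christoffel ℓ c e s) a :=
      ((hℓ.differentiableAt_christoffel ha).clm_apply (differentiableAt_const e)).clm_apply
        (differentiableAt_const s)
    have hZ : DifferentiableAt ℝ (fun c => dProj ℓ f c e s) a :=
      ((hf.differentiableAt_dProj hℓ ha).clm_apply (differentiableAt_const e)).clm_apply
        (differentiableAt_const s)
    have h1 : (fun c => nabla ℓ (fun d => vertProj ℓ f d s) c e) =ᶠ[nhds a]
        fun c => dProj ℓ f c e s - (-vertProj ℓ f c (christoffel ℓ c e s)) := by
      filter_upwards [hℓ.eventually_mem ha] with c hc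
      rw [hf.nabla_vertProj hℓ hc (differentiableAt_const s), nabla_const, sub_neg_eq_add]
    have hPY := hf.differentiableAt_vertProj_apply hℓ ha hY
    have h2 : nabla ℓ (fun c => -vertProj ℓ f c (christoffel ℓ c e s)) a b
        = -nabla ℓ (fun c => vertProj ℓ f c (christoffel ℓ c e s)) a b := by
      rw [nabla_eq, nabla_eq, fderiv_fun_neg]
      simp only [FunLike.coe_neg, Pi.neg_apply, map_neg, neg_add]
    rw [nabla_congr ℓ h1, nabla_sub ℓ hZ hPY.fun_neg, h2,
      hf.nabla_dProj hℓ ha (differentiableAt_const e), hf.nabla_vertProj hℓ ha hY, nabla_const]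
    simp only [map_sub, map_neg, map_add, hf.horProj_vertProj hℓ ha]
    abel
  rw [← hf.ricci_vertProj hℓ ha b e hs, map_sub, key b e, key e b, hℓ.christoffel_symm ha b e]
  simp only [map_add]
  abel

/-- The Gauss equation for the vertical distribution. -/
theorem curvatureTop_eq {a : E × E} (ha : a ∈ U) (b e : E) {s : E} (hs : s ∈ K a.1) :
    curvatureTop ℓ K a b e s = vertProj ℓ f a (curvature ℓ a b e s)
      + vertProj ℓ f a (dProj ℓ f a b (dProj ℓ f a e s))
      - vertProj ℓ f a (dProj ℓ f a e (dProj ℓ f a b s)) := by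
  have h0 : ∀ c ∈ U, ∀ e : E, nabla ℓ (topField ℓ K fun _ => s) c e
      = nabla ℓ (fun d => vertProj ℓ f d s) c e := fun c hc e =>
    nabla_congr ℓ (hf.topField_eventuallyEq hℓ hc fun _ => s) e
  have key : ∀ b e : E, vertProj ℓ f a (nabla ℓ (topField ℓ K
        (nablaField ℓ (fun _ => e) (topField ℓ K fun _ => s))) a b)
      = vertProj ℓ f a (dProj ℓ f a b (dProj ℓ f a e s))
        + vertProj ℓ f a (nabla ℓ (fun c => nabla ℓ (fun d => vertProj ℓ f d s) c e) a b) := by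
    intro b e
    have hY := hℓ.differentiableAt
      (hℓ.contDiffOn_nabla (hf.contDiffOn_vertProj_const hℓ s) e) ha
    have h1 : topField ℓ K (nablaField ℓ (fun _ => e) (topField ℓ K fun _ => s))
        =ᶠ[nhds a] fun c => vertProj ℓ f c (nabla ℓ (fun d => vertProj ℓ f d s) c e) := by
      filter_upwards [hℓ.eventually_mem ha] with c hc
      rw [topField, hf.top_eq hℓ hc, nablaField, h0 c hc]
    rw [nabla_congr ℓ h1, hf.nabla_vertProj hℓ ha hY, map_add, hf.vertProj_vertProj hℓ ha,
      hf.nabla_vertProj hℓ ha (differentiableAt_const s), map_add, map_add,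
      hf.vertProj_dProj_of_mem hℓ ha b (hf.vertProj_mem hℓ ha _), add_zero]
  rw [← hf.ricci_vertProj hℓ ha b e hs, curvatureTop, curvatureTopOp, hf.top_eq hℓ ha,
    lieBracket_const]
  simp only [nablaField, nabla_zero_right, sub_zero, map_sub]
  rw [key, key]
  abel

/-- The Gauss equation for the horizontal distribution. -/
theorem curvatureBot_eq {a : E × E} (ha : a ∈ U) (b e : E) {z : E} (hz : vertProj ℓ f a z = 0) :
    curvatureBot ℓ K a b e z = horProj ℓ f a (curvature ℓ a b e z)
      + horProj ℓ f a (dProj ℓ f a b (dProj ℓ f a e z))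
      - horProj ℓ f a (dProj ℓ f a e (dProj ℓ f a b z)) := by
  have hQ : ∀ y, vertProj ℓ f a (horProj ℓ f a y) = 0 := fun y => by
    rw [horProj_apply, map_sub, hf.vertProj_vertProj hℓ ha, sub_self]
  have h0 : ∀ c ∈ U, ∀ e : E, nabla ℓ (botField ℓ K fun _ => z) c e
      = nabla ℓ (fun d => horProj ℓ f d z) c e := fun c hc e =>
    nabla_congr ℓ (hf.botField_eventuallyEq hℓ hc fun _ => z) e
  have key : ∀ b e : E, horProj ℓ f a (nabla ℓ (botField ℓ K
        (nablaField ℓ (fun _ => e) (botField ℓ K fun _ => z))) a b)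
      = horProj ℓ f a (dProj ℓ f a b (dProj ℓ f a e z))
        + horProj ℓ f a (nabla ℓ (fun c => nabla ℓ (fun d => horProj ℓ f d z) c e) a b) := by
    intro b e
    have hY := hℓ.differentiableAt
      (hℓ.contDiffOn_nabla (hf.contDiffOn_horProj_const hℓ z) e) ha
    have h1 : botField ℓ K (nablaField ℓ (fun _ => e) (botField ℓ K fun _ => z))
        =ᶠ[nhds a] fun c => horProj ℓ f c (nabla ℓ (fun d => horProj ℓ f d z) c e) := by
      filter_upwards [hℓ.eventually_mem ha] with c hc
      rw [botField, hf.bot_eq hℓ hc, nablaField, h0 c hc]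
    rw [nabla_congr ℓ h1, hf.nabla_horProj hℓ ha hY, map_sub,
      hf.nabla_horProj hℓ ha (differentiableAt_const z), map_sub, map_sub,
      hf.horProj_dProj_of_hor hℓ ha b (hQ _), horProj_apply ℓ f a (horProj ℓ f a _), hQ]
    abel
  -- the fibre derivative term of the Ricci identity for `Q z` is vertical
  have hR : horProj ℓ f a (nabla ℓ (fun c => nabla ℓ (fun d => horProj ℓ f d z) c e) a b)
      - horProj ℓ f a (nabla ℓ (fun c => nabla ℓ (fun d => horProj ℓ f d z) c b) a e)
      = horProj ℓ f a (curvature ℓ a b e z) := by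
    have hd : HasFDerivAt (fun c => horProj ℓ f c z) _ a :=
      ((hasFDerivAt_const z a).sub ((hf.differentiableAt_vertProj hℓ ha).hasFDerivAt.clm_apply
        (hasFDerivAt_const z a))).congr_of_eventuallyEq
          (.of_forall fun c => horProj_apply ℓ f c z)
    rw [← map_sub, hℓ.ricci_identity ha (hf.contDiffOn_horProj_const hℓ z), map_sub, hd.fderiv,
      horProj_apply ℓ f a z, hz, sub_zero]
    simp [hf.horProj_fderiv_vertProj_fiber hℓ ha]
  rw [← hR, curvatureBot, curvatureBotOp, hf.bot_eq hℓ ha,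
    lieBracket_const]
  simp only [nablaField, nabla_zero_right, sub_zero, map_sub]
  rw [key, key]
  abel

theorem g_horProj_left {a : E × E} (ha : a ∈ U) (e : E) {z : E} (hz : vertProj ℓ f a z = 0) :
    g ℓ a e z = g ℓ a (horProj ℓ f a e) z := by
  rw [horProj_apply, map_sub, FunLike.coe_sub, Pi.sub_apply, hf.g_vertProj hℓ ha, hz, map_zero,
    sub_zero]

theorem g_vertProj_left_of_mem {a : E × E} (ha : a ∈ U) (e : E) {w : E} (hw : w ∈ K a.1) :
    g ℓ a (vertProj ℓ f a e) w = g ℓ a e w := by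
  rw [hf.g_vertProj hℓ ha, hf.vertProj_of_mem ha hw]

/-- The Gauss equation for the vertical distribution, in terms of `χ = 𝐓 + 𝐀`. -/
theorem g_curvature_vertical {a : E × E} (ha : a ∈ U) (b e : E) {s w : E} (hs : s ∈ K a.1)
    (hw : w ∈ K a.1) :
    g ℓ a (curvature ℓ a b e s) w = g ℓ a (curvatureTop ℓ K a b e s) w
      - g ℓ a (chi ℓ K a e s) (chi ℓ K a b w) + g ℓ a (chi ℓ K a b s) (chi ℓ K a e w) := by
  rw [hf.curvatureTop_eq hℓ ha b e hs, hf.chi_of_mem hℓ ha e hs, hf.chi_of_mem hℓ ha b hs,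
    hf.chi_of_mem hℓ ha e hw, hf.chi_of_mem hℓ ha b hw, ← hf.g_dProj hℓ ha, ← hf.g_dProj hℓ ha]
  simp only [map_add, map_sub, FunLike.coe_add, Pi.add_apply, FunLike.coe_sub, Pi.sub_apply,
    hf.g_vertProj_left_of_mem hℓ ha _ hw]
  ring

/-- The Gauss equation for the horizontal distribution, in terms of `χ = 𝐓 + 𝐀`. -/
theorem g_curvature_horizontal {a : E × E} (ha : a ∈ U) (b e : E) {z z' : E}
    (hz : vertProj ℓ f a z = 0) (hz' : vertProj ℓ f a z' = 0) :
    g ℓ a (curvature ℓ a b e z) z' = g ℓ a (curvatureBot ℓ K a b e z) z'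
      + g ℓ a (chi ℓ K a b z) (chi ℓ K a e z') - g ℓ a (chi ℓ K a e z) (chi ℓ K a b z') := by
  rw [hf.curvatureBot_eq hℓ ha b e hz, hf.chi_of_hor hℓ ha e hz, hf.chi_of_hor hℓ ha b hz,
    hf.chi_of_hor hℓ ha e hz', hf.chi_of_hor hℓ ha b hz']
  simp only [map_add, map_sub, map_neg, FunLike.coe_add, Pi.add_apply, FunLike.coe_sub,
    Pi.sub_apply, FunLike.coe_neg, Pi.neg_apply, neg_neg, ← hf.g_horProj_left hℓ ha _ hz',
    hf.g_dProj hℓ ha]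
  ring

/-- The Codazzi equation, in terms of `∇²P`. -/
theorem g_curvature_mixed {a : E × E} (ha : a ∈ U) (b e : E) {s z : E} (hs : s ∈ K a.1)
    (hz : vertProj ℓ f a z = 0) :
    g ℓ a (curvature ℓ a b e s) z
      = g ℓ a (ddProj ℓ f a b e s) z - g ℓ a (ddProj ℓ f a e b s) z := by
  rw [hf.g_horProj_left hℓ ha _ hz, hf.horProj_curvature hℓ ha b e hs, map_sub, FunLike.coe_sub,
    Pi.sub_apply, ← hf.g_horProj_left hℓ ha _ hz, ← hf.g_horProj_left hℓ ha _ hz]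

theorem g_nablaTensor_T {a : E × E} (ha : a ∈ U) (h : E) {b e z : E} (hb : b ∈ K a.1)
    (he : e ∈ K a.1) (hz : vertProj ℓ f a z = 0) :
    g ℓ a (nablaTensor ℓ (T ℓ K) a h b e) z
      = g ℓ a (ddProj ℓ f a h b e) z + g ℓ a (dProj ℓ f a (dProj ℓ f a h b) e) z := by
  rw [hf.g_horProj_left hℓ ha _ hz, hf.horProj_nablaTensor_T hℓ ha h hb he, map_add,
    FunLike.coe_add, Pi.add_apply, ← hf.g_horProj_left hℓ ha _ hz]

theorem g_nablaTensor_A {a : E × E} (ha : a ∈ U) (h : E) {b e z : E} (hb : vertProj ℓ f a b = 0)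
    (he : e ∈ K a.1) (hz : vertProj ℓ f a z = 0) :
    g ℓ a (nablaTensor ℓ (A ℓ K) a h b e) z
      = g ℓ a (ddProj ℓ f a h b e) z - g ℓ a (dProj ℓ f a (dProj ℓ f a h b) e) z := by
  rw [hf.g_horProj_left hℓ ha _ hz, hf.horProj_nablaTensor_A hℓ ha h hb he, map_sub,
    FunLike.coe_sub, Pi.sub_apply, ← hf.g_horProj_left hℓ ha _ hz]

/-- The symmetry of `𝐓` on vertical vectors moves a vertical vector `π_b x` to the other slot. -/
theorem g_dProj_dProj {a : E × E} (ha : a ∈ U) (b : E) {s x z : E} (hs : s ∈ K a.1)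
    (hx : vertProj ℓ f a x = 0) :
    g ℓ a (dProj ℓ f a (dProj ℓ f a b x) s) z = g ℓ a (dProj ℓ f a b x) (dProj ℓ f a s z) := by
  rw [hf.dProj_symm hℓ ha (hf.dProj_mem hℓ ha b hx) hs, hf.g_dProj hℓ ha]

/-- The fundamental equations of a submersion in coordinates. -/
theorem fundamental_equations {a : E × E} (ha : a ∈ U) {s' s u w : E}
    (hs' : s' ∈ K a.1) (hs : s ∈ K a.1) (hu : u ∈ K a.1) (hw : w ∈ K a.1)
    {x y z z' : E} (hx : ∀ t ∈ K a.1, g ℓ a x t = 0) (hy : ∀ t ∈ K a.1, g ℓ a y t = 0)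
    (hz : ∀ t ∈ K a.1, g ℓ a z t = 0) (hz' : ∀ t ∈ K a.1, g ℓ a z' t = 0) :
    g ℓ a (curvature ℓ a w u s) s' =
        g ℓ a (curvatureTop ℓ K a w u s) s'
          + g ℓ a (T ℓ K a w s) (T ℓ K a u s') - g ℓ a (T ℓ K a u s) (T ℓ K a w s') ∧
    g ℓ a (curvature ℓ a w u s) z =
        g ℓ a (nablaTensor ℓ (T ℓ K) a w u s) z - g ℓ a (nablaTensor ℓ (T ℓ K) a u w s) z ∧
    g ℓ a (curvature ℓ a x u s) w =
        g ℓ a (curvatureTop ℓ K a x u s) w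
          - g ℓ a (T ℓ K a u s) (A ℓ K a x w) + g ℓ a (A ℓ K a x s) (T ℓ K a u w) ∧
    g ℓ a (curvature ℓ a x u s) z =
        g ℓ a (nablaTensor ℓ (T ℓ K) a x u s) z - g ℓ a (nablaTensor ℓ (A ℓ K) a u x s) z
          - g ℓ a (A ℓ K a (A ℓ K a x u) s) z - g ℓ a (T ℓ K a u x) (T ℓ K a s z) ∧
    g ℓ a (curvature ℓ a x y s) w =
        g ℓ a (curvatureTop ℓ K a x y s) w
          - g ℓ a (A ℓ K a y s) (A ℓ K a x w) + g ℓ a (A ℓ K a x s) (A ℓ K a y w) ∧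
    g ℓ a (curvature ℓ a x y s) z =
        g ℓ a (nablaTensor ℓ (A ℓ K) a x y s) z - g ℓ a (nablaTensor ℓ (A ℓ K) a y x s) z
          - g ℓ a (A ℓ K a y x) (T ℓ K a s z) + g ℓ a (A ℓ K a x y) (T ℓ K a s z) ∧
    g ℓ a (curvature ℓ a x y z) z' =
        g ℓ a (curvatureBot ℓ K a x y z) z'
          + g ℓ a (A ℓ K a x z) (A ℓ K a y z') - g ℓ a (A ℓ K a y z) (A ℓ K a x z') := by
  rw [← hf.vertProj_eq_zero_iff hℓ ha] at hx hy hz hz'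
  have hxu : vertProj ℓ f a (dProj ℓ f a x u) = 0 := hf.vertProj_dProj_of_mem hℓ ha x hu
  simp only [hf.T_eq hℓ ha hu, hf.T_eq hℓ ha hs, hf.T_eq hℓ ha hw, hf.A_eq hℓ ha hx,
    hf.A_eq hℓ ha hy]
  refine ⟨?_, ?_, hf.g_curvature_vertical hℓ ha x u hs hw, ?_,
    hf.g_curvature_vertical hℓ ha x y hs hw, ?_, hf.g_curvature_horizontal hℓ ha x y hz hz'⟩
  · rw [hf.g_curvature_vertical hℓ ha w u hs hs']
    ring
  · rw [hf.g_curvature_mixed hℓ ha w u hs hz, hf.g_nablaTensor_T hℓ ha w hu hs hz,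
      hf.g_nablaTensor_T hℓ ha u hw hs hz, hf.dProj_symm hℓ ha hu hw]
    ring
  · rw [hf.g_curvature_mixed hℓ ha x u hs hz, hf.g_nablaTensor_T hℓ ha x hu hs hz,
      hf.g_nablaTensor_A hℓ ha u hx hs hz, hf.chi_of_mem hℓ ha x hu, hf.A_eq hℓ ha hxu,
      hf.chi_of_mem hℓ ha _ hs, hf.chi_of_hor hℓ ha u hx, hf.chi_of_hor hℓ ha s hz,
      hf.g_dProj_dProj hℓ ha u hs hx]
    simp
    ring
  · rw [hf.g_curvature_mixed hℓ ha x y hs hz, hf.g_nablaTensor_A hℓ ha x hy hs hz,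
      hf.g_nablaTensor_A hℓ ha y hx hs hz, hf.chi_of_hor hℓ ha x hy, hf.chi_of_hor hℓ ha y hx,
      hf.chi_of_hor hℓ ha s hz, hf.g_dProj_dProj hℓ ha x hs hy, hf.g_dProj_dProj hℓ ha y hs hx]
    simp
    ring

end IsSubmersion
end Finsler.Coord

namespace Finsler

/-! ### Passage to a chart -/

/-- The half Hessian is natural under linear changes of coordinates. -/
theorem halfHessian_comp {E : Type*} [NormedAddCommGroup E] [NormedSpace ℝ E] (f : E → ℝ)
    (J : E ≃L[ℝ] E) (y e h : E) :
    halfHessian (fun y => f (J y)) y e h = halfHessian f (J y) (J e) (J h) := by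
  let C : (E →L[ℝ] ℝ) ≃L[ℝ] (E →L[ℝ] ℝ) := J.symm.arrowCongr (ContinuousLinearEquiv.refl ℝ ℝ)
  have h1 : fderiv ℝ (fun y => f (J y)) = C ∘ (fderiv ℝ f ∘ J) := by
    ext z w
    have := J.comp_right_fderiv (f := f) (x := z)
    rw [show (fun y => f (J y)) = f ∘ J from rfl, this]
    rfl
  have h2 : fderiv ℝ (fderiv ℝ fun y => f (J y)) y e h
      = fderiv ℝ (fderiv ℝ f) (J y) (J e) (J h) := by
    rw [h1, C.comp_fderiv, J.comp_right_fderiv]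
    rfl
  simp only [halfHessian, FunLike.coe_smul, Pi.smul_apply, h2]

section Chart

variable {E : Type*} [NormedAddCommGroup E] [NormedSpace ℝ E]
  {M : Type*} [TopologicalSpace M] [ChartedSpace E M]
  {φ : OpenPartialHomeomorph M E} (hφ : φ ∈ IsManifold.maximalAtlas 𝓘(ℝ, E) ∞ M)
include hφ

theorem mdifferentiable_of_mem_maximalAtlas : φ.MDifferentiable 𝓘(ℝ, E) 𝓘(ℝ, E) :=
  ⟨(contMDiffOn_of_mem_maximalAtlas hφ).mdifferentiableOn (by simp),
    (contMDiffOn_symm_of_mem_maximalAtlas hφ).mdifferentiableOn (by simp)⟩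

theorem ofChart_toChart {p : M} (hp : p ∈ φ.source) (e : E) :
    (ofChart φ (φ p) (toChart φ p e) : E) = e :=
  DFunLike.congr_fun ((mdifferentiable_of_mem_maximalAtlas hφ).symm_comp_deriv hp) e

theorem ofChart_surjective {x : E} (hx : x ∈ φ.target) : Function.Surjective (ofChart φ x) :=
  (mdifferentiable_of_mem_maximalAtlas hφ).symm.mfderiv_surjective hx

theorem ofChart_injective {x : E} (hx : x ∈ φ.target) : Function.Injective (ofChart φ x) :=
  (mdifferentiable_of_mem_maximalAtlas hφ).symm.mfderiv_injective hx

theorem toChart_ofChartAt {p : M} (hp : p ∈ φ.source) (e : E) :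
    toChart φ p (ofChartAt φ p e) = e :=
  ContinuousLinearMap.IsInvertible.self_apply_inverse
    ⟨(mdifferentiable_of_mem_maximalAtlas hφ).mfderiv hp, rfl⟩ e

omit hφ in
theorem contMDiff_prod_toTangentBundle : ContMDiff 𝓘(ℝ, E × E) 𝓘(ℝ, E).tangent ∞
    (fun a : E × E => (⟨a.1, a.2⟩ : TangentBundle 𝓘(ℝ, E) E)) := by
  rw [modelWithCornersSelf_prod]
  exact contMDiff_tangentBundleModelSpaceHomeomorph_symm (I := 𝓘(ℝ, E)) (n := ∞)

omit hφ in
theorem tangentMapWithin_symm_eq {a : E × E} (ha : a.1 ∈ φ.target) :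
    (⟨φ.symm a.1, ofChart φ a.1 a.2⟩ : TangentBundle 𝓘(ℝ, E) M)
      = tangentMapWithin 𝓘(ℝ, E) 𝓘(ℝ, E) φ.symm φ.target ⟨a.1, a.2⟩ := by
  have h : mfderivWithin 𝓘(ℝ, E) 𝓘(ℝ, E) φ.symm φ.target a.1
      = mfderiv 𝓘(ℝ, E) 𝓘(ℝ, E) φ.symm a.1 := mfderivWithin_of_isOpen φ.open_target ha
  simp only [tangentMapWithin, h]
  rfl

/-- The passage from coordinates to the tangent bundle is smooth. -/
theorem contMDiffOn_tangentMap_symm [IsManifold 𝓘(ℝ, E) ∞ M] :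
    ContMDiffOn 𝓘(ℝ, E × E) 𝓘(ℝ, E).tangent ∞
      (fun a : E × E => (⟨φ.symm a.1, ofChart φ a.1 a.2⟩ : TangentBundle 𝓘(ℝ, E) M))
      (Prod.fst ⁻¹' φ.target) := by
  have h1 := (contMDiffOn_symm_of_mem_maximalAtlas hφ).contMDiffOn_tangentMapWithin (m := ∞)
    (by simp) φ.open_target.uniqueMDiffOn
  have h3 := h1.comp (contMDiff_prod_toTangentBundle (E := E)).contMDiffOn
    (s := Prod.fst ⁻¹' φ.target) fun a ha => ha
  exact h3.congr fun a ha => tangentMapWithin_symm_eq ha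

end Chart

section Transport

variable {E : Type*} [NormedAddCommGroup E] [NormedSpace ℝ E]
  {F : Type*} [NormedAddCommGroup F] [NormedSpace ℝ F]
  {M : Type*} [TopologicalSpace M] [ChartedSpace E M] [IsManifold 𝓘(ℝ, E) ∞ M]
  {B : Type*} [TopologicalSpace B] [ChartedSpace F B] [IsManifold 𝓘(ℝ, F) ∞ B]
  (m : PseudoFinslerMetric E M)

/-- The coordinates of the admissible vectors at the points of `φ⁻¹(W)`. -/
def admissibleInChart (φ : OpenPartialHomeomorph M E) (W : Set M) : Set (E × E) :=
  {a | a.1 ∈ φ.target ∧ φ.symm a.1 ∈ W ∧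
    (⟨φ.symm a.1, ofChart φ a.1 a.2⟩ : TangentBundle 𝓘(ℝ, E) M) ∈ m.𝒜}

-- The tangent spaces at all points are the model space `E`, so that the next three lemmas are
-- about the same vectors of `E`, seen at the points `q = p`.

theorem mk_mem_iff_of_eq {p q : M} (h : q = p) {v' : TangentSpace 𝓘(ℝ, E) q}
    {v : TangentSpace 𝓘(ℝ, E) p} (hv : (v' : E) = v) :
    (⟨q, v'⟩ : TangentBundle 𝓘(ℝ, E) M) ∈ m.𝒜 ↔ m.Admissible v := by
  subst h
  obtain rfl : v' = v := hv
  rfl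

theorem g_eq_of_eq {p q : M} (h : q = p) {v' e' k' : TangentSpace 𝓘(ℝ, E) q}
    {v e k : TangentSpace 𝓘(ℝ, E) p} (hv : (v' : E) = v) (he : (e' : E) = e) (hk : (k' : E) = k) :
    m.g v' e' k' = m.g v e k := by
  subst h
  obtain rfl : v' = v := hv
  obtain rfl : e' = e := he
  obtain rfl : k' = k := hk
  rfl

omit [IsManifold 𝓘(ℝ, E) ∞ M] [IsManifold 𝓘(ℝ, F) ∞ B] in
theorem mem_verticalSpace_iff_of_eq (σ : M → B) {p q : M} (h : q = p) {e' : TangentSpace 𝓘(ℝ, E) q}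
    {e : TangentSpace 𝓘(ℝ, E) p} (he : (e' : E) = e) :
    e' ∈ verticalSpace E F σ q ↔ e ∈ verticalSpace E F σ p := by
  subst h
  obtain rfl : e' = e := he
  rfl

variable {φ : OpenPartialHomeomorph M E} (hφ : φ ∈ IsManifold.maximalAtlas 𝓘(ℝ, E) ∞ M)
include hφ

theorem g_inChart {x : E} (hx : x ∈ φ.target) (y e h : E) :
    Coord.g (m.inChart φ) (x, y) e h
      = m.g (ofChart φ x y) (ofChart φ x e) (ofChart φ x h) := by
  let J : E ≃L[ℝ] E := (mdifferentiable_of_mem_maximalAtlas hφ).symm.mfderiv hx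
  exact halfHessian_comp (fun z : E => m.L (⟨φ.symm x, z⟩ : TangentBundle 𝓘(ℝ, E) M)) J y e h

theorem g_eq_coord {p : M} (hp : p ∈ φ.source) (v e h : TangentSpace 𝓘(ℝ, E) p) :
    m.g v e h = Coord.g (m.inChart φ) (coords φ v) (toChart φ p e) (toChart φ p h) := by
  rw [coords, g_inChart m hφ (φ.map_source hp)]
  exact (g_eq_of_eq m (φ.left_inv hp) (ofChart_toChart hφ hp v) (ofChart_toChart hφ hp e)
    (ofChart_toChart hφ hp h)).symm

theorem coords_mem {p : M} (hp : p ∈ φ.source) {W : Set M} (hW : p ∈ W)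
    {v : TangentSpace 𝓘(ℝ, E) p} (hv : m.Admissible v) :
    coords φ v ∈ admissibleInChart m φ W := by
  refine ⟨φ.map_source hp, ?_, ?_⟩
  · simpa [coords, φ.left_inv hp] using hW
  · exact (mk_mem_iff_of_eq m (φ.left_inv hp) (ofChart_toChart hφ hp v)).2 hv

omit [IsManifold 𝓘(ℝ, E) ∞ M] [IsManifold 𝓘(ℝ, F) ∞ B] in
theorem mem_verticalInChart {p : M} (hp : p ∈ φ.source) (σ : M → B)
    (e : TangentSpace 𝓘(ℝ, E) p) :
    toChart φ p e ∈ verticalInChart F σ φ (φ p) ↔ e ∈ verticalSpace E F σ p :=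
  mem_verticalSpace_iff_of_eq σ (φ.left_inv hp) (ofChart_toChart hφ hp e)

theorem isOpen_admissibleInChart {W : Set M} (hW : IsOpen W) :
    IsOpen (admissibleInChart m φ W) := by
  have h1 : IsOpen (Prod.fst ⁻¹' φ.target : Set (E × E)) := φ.open_target.preimage continuous_fst
  have h2 := (contMDiffOn_tangentMap_symm hφ).continuousOn.isOpen_inter_preimage h1 m.isOpen_𝒜
  have h3 : IsOpen (Prod.fst ⁻¹' (φ.target ∩ φ.symm ⁻¹' W) : Set (E × E)) :=
    (φ.symm.isOpen_inter_preimage hW).preimage continuous_fst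
  convert h2.inter h3 using 1
  ext a
  simp only [admissibleInChart, Set.mem_ofPred_eq, Set.mem_inter_iff, Set.mem_preimage]
  tauto

/-- A pseudo-Finsler metric is a Lagrangian in every chart. -/
theorem isLagrangian_inChart {W : Set M} (hW : IsOpen W) :
    Coord.IsLagrangian (m.inChart φ) (admissibleInChart m φ W) where
  isOpen := isOpen_admissibleInChart m hφ hW
  contDiffOn := by
    rw [← contMDiffOn_iff_contDiffOn]
    exact m.smooth.comp ((contMDiffOn_tangentMap_symm hφ).mono fun a ha => ha.1)
      fun a ha => ha.2.2
  smul_mem a ha c hc := by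
    refine ⟨ha.1, ha.2.1, ?_⟩
    have := m.smul_mem _ _ c hc ha.2.2
    rwa [← map_smul] at this
  homogeneous a ha c hc := by
    have := m.homogeneous _ _ c hc ha.2.2
    rwa [← map_smul] at this
  nondegenerate a ha e he := by
    refine ofChart_injective hφ ha.1 ((m.nondegenerate _ _ ha.2.2 _ fun h => ?_).trans
      (map_zero _).symm)
    obtain ⟨k, rfl⟩ := ofChart_surjective hφ ha.1 h
    exact (g_inChart m hφ ha.1 a.2 e k).symm.trans (he k)

/-- A submersion with nondegenerate vertical spaces is given, in a chart of the total space and a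
chart `ψ` of the base, by a submersion between open sets of the model spaces. -/
theorem isSubmersion_inChart {m' : PseudoFinslerMetric F B} {σ : M → B}
    (hσ : IsPseudoFinslerSubmersion m m' σ)
    (hvert : ∀ (q : M) (v : TangentSpace 𝓘(ℝ, E) q), m.Admissible v →
      m.VerticalNondegenerateAt F σ v)
    {ψ : OpenPartialHomeomorph B F} (hψ : ψ ∈ IsManifold.maximalAtlas 𝓘(ℝ, F) ∞ B) :
    Coord.IsSubmersion (m.inChart φ) (admissibleInChart m φ (σ ⁻¹' ψ.source))
      (fun x => ψ (σ (φ.symm x))) (verticalInChart F σ φ) := by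
  have hfd : ∀ a ∈ admissibleInChart m φ (σ ⁻¹' ψ.source), ∀ e : E,
      fderiv ℝ (fun x => ψ (σ (φ.symm x))) a.1 e
        = mfderiv 𝓘(ℝ, F) 𝓘(ℝ, F) ψ (σ (φ.symm a.1))
          (mfderiv 𝓘(ℝ, E) 𝓘(ℝ, F) σ (φ.symm a.1) (ofChart φ a.1 e)) := by
    intro a ha e
    have h1 := ((mdifferentiable_of_mem_maximalAtlas hφ).mdifferentiableAt_symm ha.1).hasMFDerivAt
    have h2 := (hσ.smooth.mdifferentiableAt (by simp) (x := φ.symm a.1)).hasMFDerivAt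
    have h3 := ((mdifferentiable_of_mem_maximalAtlas hψ).mdifferentiableAt ha.2.1).hasMFDerivAt
    have h4 := (h3.comp (φ.symm a.1) h2).comp a.1 h1
    have h5 := h4.mfderiv
    rw [mfderiv_eq_fderiv] at h5
    exact DFunLike.congr_fun h5 e
  refine ⟨fun a ha => ?_, fun a ha y => ?_, fun a ha e => ?_, fun a ha u hu hu' => ?_⟩
  · rw [← contMDiffAt_iff_contDiffAt]
    exact (contMDiffAt_of_mem_maximalAtlas hψ ha.2.1).comp a.1
      (hσ.smooth.contMDiffAt.comp a.1 (contMDiffAt_symm_of_mem_maximalAtlas hφ ha.1))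
  · obtain ⟨w, rfl⟩ := (mdifferentiable_of_mem_maximalAtlas hψ).mfderiv_surjective ha.2.1 y
    obtain ⟨u, rfl⟩ := hσ.surjective_mfderiv _ w
    obtain ⟨e, rfl⟩ := ofChart_surjective hφ ha.1 u
    exact ⟨e, hfd a ha e⟩
  · rw [hfd a ha]
    have h1 := (mdifferentiable_of_mem_maximalAtlas hψ).mfderiv_injective ha.2.1
    exact (map_eq_zero_iff _ h1).symm
  · refine ofChart_injective hφ ha.1 ((hvert _ _ ha.2.2 _ hu fun w hw => ?_).trans
      (map_zero _).symm)
    obtain ⟨k, rfl⟩ := ofChart_surjective hφ ha.1 w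
    exact (g_inChart m hφ ha.1 a.2 u k).symm.trans (hu' k hw)

end Transport

end Finsler

end

theorem mainTheorem2
    {E : Type*} [NormedAddCommGroup E] [NormedSpace ℝ E] [FiniteDimensional ℝ E]
    {F : Type*} [NormedAddCommGroup F] [NormedSpace ℝ F] [FiniteDimensional ℝ F]
    {M : Type*} [TopologicalSpace M] [ChartedSpace E M] [IsManifold 𝓘(ℝ, E) ∞ M]
    {B : Type*} [TopologicalSpace B] [ChartedSpace F B] [IsManifold 𝓘(ℝ, F) ∞ B]
    (m : Finsler.PseudoFinslerMetric E M) (m' : Finsler.PseudoFinslerMetric F B) (σ : M → B)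
    (hσ : Finsler.IsPseudoFinslerSubmersion m m' σ)
    (hvert : ∀ (q : M) (v : TangentSpace 𝓘(ℝ, E) q), m.Admissible v →
      m.VerticalNondegenerateAt F σ v)
    (p : M) (φ : OpenPartialHomeomorph M E) (hφ : φ ∈ IsManifold.maximalAtlas 𝓘(ℝ, E) ∞ M)
    (hp : p ∈ φ.source)
    (v : TangentSpace 𝓘(ℝ, E) p) (hv : m.Admissible v)
    (s' s u w : TangentSpace 𝓘(ℝ, E) p)
    (hs' : s' ∈ Finsler.verticalSpace E F σ p) (hs : s ∈ Finsler.verticalSpace E F σ p)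
    (hu : u ∈ Finsler.verticalSpace E F σ p) (hw : w ∈ Finsler.verticalSpace E F σ p)
    (x y z z' : TangentSpace 𝓘(ℝ, E) p)
    (hx : m.IsHorizontal F σ v x) (hy : m.IsHorizontal F σ v y)
    (hz : m.IsHorizontal F σ v z) (hz' : m.IsHorizontal F σ v z') :
    -- {0}
    m.g v (m.R φ v w u s) s' =
        m.g v (m.Rtop F σ φ v w u s) s'
          + m.g v (m.T F σ φ v w s) (m.T F σ φ v u s')
          - m.g v (m.T F σ φ v u s) (m.T F σ φ v w s') ∧
    -- {1}
    m.g v (m.R φ v w u s) z =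
        m.g v (m.nablaT F σ φ v w u s) z - m.g v (m.nablaT F σ φ v u w s) z ∧
    -- {1'}
    m.g v (m.R φ v x u s) w =
        m.g v (m.Rtop F σ φ v x u s) w
          - m.g v (m.T F σ φ v u s) (m.A F σ φ v x w)
          + m.g v (m.A F σ φ v x s) (m.T F σ φ v u w) ∧
    -- {2}
    m.g v (m.R φ v x u s) z =
        m.g v (m.nablaT F σ φ v x u s) z
          - m.g v (m.nablaA F σ φ v u x s) z
          - m.g v (m.A F σ φ v (m.A F σ φ v x u) s) z
          - m.g v (m.T F σ φ v u x) (m.T F σ φ v s z) ∧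
    -- {2'}
    m.g v (m.R φ v x y s) w =
        m.g v (m.Rtop F σ φ v x y s) w
          - m.g v (m.A F σ φ v y s) (m.A F σ φ v x w)
          + m.g v (m.A F σ φ v x s) (m.A F σ φ v y w) ∧
    -- {3}
    m.g v (m.R φ v x y s) z =
        m.g v (m.nablaA F σ φ v x y s) z - m.g v (m.nablaA F σ φ v y x s) z
          - m.g v (m.A F σ φ v y x) (m.T F σ φ v s z)
          + m.g v (m.A F σ φ v x y) (m.T F σ φ v s z) ∧
    -- {4}
    m.g v (m.R φ v x y z) z' =
        m.g v (m.Rbot F σ φ v x y z) z'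
          + m.g v (m.A F σ φ v x z) (m.A F σ φ v y z')
          - m.g v (m.A F σ φ v y z) (m.A F σ φ v x z') := by
  have hψ := IsManifold.chart_mem_maximalAtlas (I := 𝓘(ℝ, F)) (n := ∞) (σ p)
  have hℓ := Finsler.isLagrangian_inChart m hφ
    ((chartAt F (σ p)).open_source.preimage hσ.smooth.continuous)
  have hf := Finsler.isSubmersion_inChart m hφ hσ hvert hψ
  have ha := Finsler.coords_mem m hφ hp (W := σ ⁻¹' (chartAt F (σ p)).source)
    (mem_chart_source F (σ p)) hv
  have hver : ∀ e : TangentSpace 𝓘(ℝ, E) p, e ∈ Finsler.verticalSpace E F σ p →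
      Finsler.toChart φ p e ∈ Finsler.verticalInChart F σ φ (Finsler.coords φ v).1 :=
    fun e he => (Finsler.mem_verticalInChart hφ hp σ e).2 he
  have hhor : ∀ e : TangentSpace 𝓘(ℝ, E) p, m.IsHorizontal F σ v e →
      ∀ t ∈ Finsler.verticalInChart F σ φ (Finsler.coords φ v).1,
        Finsler.Coord.g (m.inChart φ) (Finsler.coords φ v) (Finsler.toChart φ p e) t = 0 := by
    intro e he t ht
    have h1 : Finsler.toChart φ p (Finsler.ofChartAt φ p t) = t :=
      Finsler.toChart_ofChartAt hφ hp t
    rw [← h1, ← Finsler.g_eq_coord m hφ hp]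
    exact he _ ((Finsler.mem_verticalInChart hφ hp σ _).1 (h1.symm ▸ ht))
  have key := hf.fundamental_equations hℓ ha (hver s' hs') (hver s hs) (hver u hu) (hver w hw)
    (hhor x hx) (hhor y hy) (hhor z hz) (hhor z' hz')
  simp only [Finsler.g_eq_coord m hφ hp, Finsler.PseudoFinslerMetric.R,
    Finsler.PseudoFinslerMetric.Rtop, Finsler.PseudoFinslerMetric.Rbot,
    Finsler.PseudoFinslerMetric.T, Finsler.PseudoFinslerMetric.A,
    Finsler.PseudoFinslerMetric.nablaT, Finsler.PseudoFinslerMetric.nablaA,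
    Finsler.toChart_ofChartAt hφ hp]
  exact key
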